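/- Let $a<b$, let $V\subseteq\mathbb R^l$ be compact and let $U\subseteq\mathbb R^m$ be a bounded *impulse domain*: for every bounded interval $I$, every $u\in\mathcal L^1(I;U)$ and every $t\in I$ there are $u_k\in AC(I;U)$ with $\|u_k-u\|_1\to0$ and $u_k(t)\to u(t)$. (Here $\mathcal L^1$ denotes everywhere defined integrable functions, $L^1$ their classes modulo a.e. equality, $AC$ absolutely continuous functions.) Let $\tilde f:\mathbb R^{n}\times\mathbb R^m\times V\to\mathbb R^n$ and $\tilde g_1,\dots,\tilde g_m:\mathbb R^{n}\times\mathbb R^m\to\mathbb R^n$, and put on $\mathbb R^{n+m}$ $$f(x,z,v)=(\tilde f(x,z,v),0),\qquad g_\alpha(x,z)=(\tilde g_\alpha(x,z),e_\alpha).$$ Assume: $f(\cdot,\cdot,v)$ is locally Lipschitz for each $v\in V$; $f(x,z,\cdot)$ is continuous on $V$ for each $(x,z)$; $|f(x,z,v)|\le M(1+|(x,z)|)$ for all $(x,z)$ and $v\in V$; each $g_\alpha$ is of class $C^1$ with $|g_\alpha(x,z)|\le N(1+|(x,z)|)$; and (commutativity) $[g_\alpha,g_\beta]=0$ for all $\alpha,\beta$.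 Let $\exp(h)(p)$ be the value at time $1$ of the solution of $\dot\gamma=h(\gamma)$, $\gamma(0)=p$. Put $\varphi(x,z)=\mathrm{Pr}\big(\exp(-\sum_\alpha z_\alpha g_\alpha)(x,z)\big)$ with $\mathrm{Pr}(x,z)=x$, $\phi(x,z)=(\varphi(x,z),z)$, and let $F(\xi,\zeta,v)\in\mathbb R^n$ be the first $n$ components of $D\phi(x,z)f(x,z,v)$ at $(x,z)=\phi^{-1}(\xi,\zeta)$ (the last $m$ components vanish). Assume finally that for all $\xi_0\in\mathbb R^n$, $u\in\mathcal L^1([a,b];U)$, $v\in L^1([a,b];V)$ the Cauchy problem $\dot\xi=F(\xi,u,v)$, $\xi(a)=\xi_0$, has a unique Carathéodory solution on $[a,b]$. For $\bar x\in\mathbb R^n$, $u\in\mathcal L^1([a,b];U)$, $v\in L^1([a,b];V)$, a map $x:[a,b]\to\mathbb R^n$ is a *pointwise defined (p.d.) solution* of $$\dot x=\tilde f(x,u,v)+\sum_{\alpha=1}^m\tilde g_\alpha(x,u)\,\dot u^\alpha,\qquad x(a)=\bar x,$$ if for every $t\in[a,b]$ there are $u_k\in AC([a,b];U)$ with $u_k\to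 u$ in $L^1$, $u_k(a)\to u(a)$, $u_k(t)\to u(t)$, and Carathéodory solutions $x_k$ on $[a,b]$ of the system with controls $(u_k,v)$ and $x_k(a)=\bar x$, such that $(x_k)$ is uniformly bounded, $x_k\to x$ in $L^1$ and $x_k(t)\to x(t)$. Then for every $\bar x\in\mathbb R^n$, $u\in\mathcal L^1([a,b];U)$ and $v\in L^1([a,b];V)$ there is exactly one p.d. solution $x$ on $[a,b]$. Moreover, if $\xi$ is the Carathéodory solution of $\dot\xi=F(\xi,u,v)$, $\xi(a)=\varphi(\bar x,u(a))$, then for every $t\in[a,b]$ $$(x(t),u(t))=\phi^{-1}(\xi(t),u(t)),\qquad\text{i.e.}\qquad x(t)=\mathrm{Pr}\Big(\exp\big(\textstyle\sum_\alpha u_\alpha(t)g_\alpha\big)(\xi(t),0)\Big);$$ if the $\tilde g_\alpha$ do not depend on $z$, this reads $x(t)=\varphi(\xi(t),-u(t))$. -/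

import Mathlib

open Set Filter Topology MeasureTheory

/-- `ℝᵈ` with the Euclidean norm. -/
abbrev Euc (d : ℕ) : Type := EuclideanSpace ℝ (Fin d)

namespace Impulsive

/-! ### Function classes on a compact interval -/

/-- `u ∈ 𝓛¹([a,b]; S)`: an everywhere defined integrable function with values in `S`. -/
def IsL1 {d : ℕ} (u : ℝ → Euc d) (a b : ℝ) (S : Set (Euc d)) : Prop :=
  IntegrableOn u (Icc a b) ∧ ∀ t ∈ Icc a b, u t ∈ S

/-- `v` represents an element of `L¹([a,b]; S)`: its values are in `S` almost everywhere. -/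
def IsL1ae {d : ℕ} (v : ℝ → Euc d) (a b : ℝ) (S : Set (Euc d)) : Prop :=
  IntegrableOn v (Icc a b) ∧ ∀ᵐ t ∂(volume.restrict (Icc a b)), v t ∈ S

/-- `u ∈ AC([a,b]; S)`. -/
def IsAC {d : ℕ} (u : ℝ → Euc d) (a b : ℝ) (S : Set (Euc d)) : Prop :=
  AbsolutelyContinuousOnInterval u a b ∧ ∀ t ∈ Icc a b, u t ∈ S

/-- Convergence `w k → y` in `L¹([a,b]; ℝᵈ)`. -/
def TendstoL1 {d : ℕ} (w : ℕ → ℝ → Euc d) (y : ℝ → Euc d) (a b : ℝ) : Prop :=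
  (∀ k, IntegrableOn (w k) (Icc a b)) ∧ IntegrableOn y (Icc a b) ∧
    Tendsto (fun k => ∫ t in Icc a b, ‖w k t - y t‖) atTop (𝓝 0)

/-- Impulse domains. (It is enough to consider compact intervals: an integrable function on a
bounded interval extends to the closure of the interval, with values in the same set.) -/
def IsImpulseDomain {m : ℕ} (U : Set (Euc m)) : Prop :=
  ∀ c d : ℝ, c < d → ∀ u : ℝ → Euc m, IsL1 u c d U → ∀ t ∈ Icc c d,
    ∃ w : ℕ → ℝ → Euc m, (∀ k, IsAC (w k) c d U) ∧ TendstoL1 w u c d ∧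
      Tendsto (fun k => w k t) atTop (𝓝 (u t))

/-! ### Vector fields on `ℝⁿ × ℝᵐ` and the change of coordinates -/

variable {n m l : ℕ}

/-- The vector field `f = f̃ʲ ∂/∂xʲ` on `ℝⁿ × ℝᵐ`. -/
def liftF (ft : Euc n × Euc m → Euc l → Euc n) (p : Euc n × Euc m) (v : Euc l) :
    Euc n × Euc m :=
  (ft p v, 0)

/-- The vector fields `g_α = g̃_αʲ ∂/∂xʲ + ∂/∂z^α` on `ℝⁿ × ℝᵐ`. -/
noncomputable def liftG (gt : Fin m → Euc n × Euc m → Euc n) (α : Fin m)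
    (p : Euc n × Euc m) : Euc n × Euc m :=
  (gt α p, EuclideanSpace.single α 1)

/-- The vector field `c_α g_α` for a constant vector `c ∈ ℝᵐ`. -/
noncomputable def combG (gt : Fin m → Euc n × Euc m → Euc n) (c : Euc m)
    (p : Euc n × Euc m) : Euc n × Euc m :=
  ∑ α, c α • liftG gt α p

/-- `γ` solves `γ' = h(γ)`, `γ(0) = p` on `[0,1]`. -/
def IsIntegralCurve01 {E : Type*} [NormedAddCommGroup E] [NormedSpace ℝ E]
    (h : E → E) (p : E) (γ : ℝ → E) : Prop :=
  γ 0 = p ∧ ∀ s ∈ Icc (0 : ℝ) 1, HasDerivWithinAt γ (h (γ s)) (Icc 0 1) s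

open Classical in
/-- `exp(h)(p)`: the value at time `1` of the solution of `γ' = h(γ)`, `γ(0) = p`
(and `p` if there is no solution on `[0,1]`). -/
noncomputable def vexp {E : Type*} [NormedAddCommGroup E] [NormedSpace ℝ E]
    (h : E → E) (p : E) : E :=
  if H : ∃ γ : ℝ → E, IsIntegralCurve01 h p γ then H.choose 1 else p

/-- `φ(x,z) = Pr (exp(-z_α g_α)(x,z))`, as a map to `ℝⁿ`. -/
noncomputable def varphi (gt : Fin m → Euc n × Euc m → Euc n) (p : Euc n × Euc m) : Euc n :=
  (vexp (combG gt (-p.2)) p).1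

/-- The change of coordinates `(x,z) ↦ (φ(x,z), z)` of `ℝⁿ × ℝᵐ`. -/
noncomputable def phi (gt : Fin m → Euc n × Euc m → Euc n) (p : Euc n × Euc m) :
    Euc n × Euc m :=
  (varphi gt p, p.2)

/-- The inverse of the change of coordinates. -/
noncomputable def phiInv (gt : Fin m → Euc n × Euc m → Euc n) :
    Euc n × Euc m → Euc n × Euc m :=
  Function.invFun (phi gt)

/-- The `ℝⁿ`-component of the transformed field
`F(ξ,ζ,v) = Dφ(x,z) f(x,z,v)`, where `(x,z)` is the point with new coordinates `(ξ,ζ)`. -/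
noncomputable def Ftilde (ft : Euc n × Euc m → Euc l → Euc n)
    (gt : Fin m → Euc n × Euc m → Euc n) (q : Euc n × Euc m) (v : Euc l) : Euc n :=
  (fderiv ℝ (phi gt) (phiInv gt q) (liftF ft (phiInv gt q) v)).1

/-! ### Solutions -/

/-- `ξ` is a Carathéodory solution of `ξ' = F(ξ,u,v)`, `ξ(a) = ξ₀` on `[a,b]`. -/
def IsXiSolution (ft : Euc n × Euc m → Euc l → Euc n) (gt : Fin m → Euc n × Euc m → Euc n)
    (a b : ℝ) (u : ℝ → Euc m) (v : ℝ → Euc l) (ξ₀ : Euc n) (ξ : ℝ → Euc n) : Prop :=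
  AbsolutelyContinuousOnInterval ξ a b ∧ ξ a = ξ₀ ∧
    ∀ᵐ t ∂(volume.restrict (Icc a b)), HasDerivAt ξ (Ftilde ft gt (ξ t, u t) (v t)) t

/-- For `u` absolutely continuous: `x` is a Carathéodory solution on `[a,b]` of
`x' = f̃(x,u,v) + ∑ g̃_α(x,u) (u^α)'`, `x(a) = x₀`. -/
def IsCaratheodorySolution (ft : Euc n × Euc m → Euc l → Euc n)
    (gt : Fin m → Euc n × Euc m → Euc n)
    (a b : ℝ) (u : ℝ → Euc m) (v : ℝ → Euc l) (x₀ : Euc n) (x : ℝ → Euc n) : Prop :=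
  AbsolutelyContinuousOnInterval x a b ∧ x a = x₀ ∧
    ∀ᵐ t ∂(volume.restrict (Icc a b)),
      HasDerivAt x (ft (x t, u t) (v t) + ∑ α, (deriv u t) α • gt α (x t, u t)) t

/-- `x` is a pointwise defined solution on `[a,b]` for the initial point `x₀` and the
controls `u`, `v`. -/
def IsPDSolution (ft : Euc n × Euc m → Euc l → Euc n) (gt : Fin m → Euc n × Euc m → Euc n)
    (U : Set (Euc m)) (a b : ℝ) (u : ℝ → Euc m) (v : ℝ → Euc l) (x₀ : Euc n)
    (x : ℝ → Euc n) : Prop :=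
  ∀ t ∈ Icc a b, ∃ (uk : ℕ → ℝ → Euc m) (xk : ℕ → ℝ → Euc n),
    (∀ k, IsAC (uk k) a b U) ∧ TendstoL1 uk u a b ∧
    Tendsto (fun k => uk k a) atTop (𝓝 (u a)) ∧ Tendsto (fun k => uk k t) atTop (𝓝 (u t)) ∧
    (∀ k, IsCaratheodorySolution ft gt a b (uk k) v x₀ (xk k)) ∧
    (∃ C : ℝ, ∀ k, ∀ s ∈ Icc a b, ‖xk k s‖ ≤ C) ∧
    TendstoL1 xk x a b ∧ Tendsto (fun k => xk k t) atTop (𝓝 (x t))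

end Impulsive

/-! The commuting fields `g_α` are straightened simultaneously. Since their flows commute, the map
`(ξ,ζ) ↦ exp(ζ_α g_α)(ξ,0)` (`coordInv`) carries `∂/∂ζ_α` to `g_α`, and it is the `C¹` inverse of
`phi`. Along an absolutely continuous control the velocity of `(x,u)` is `f` plus a combination of
the `g_α` with coefficients the derivative of `u`; `Dφ` sends that combination into `{0} × ℝᵐ`, so
`ξ = φ(x,u)` satisfies `ξ' = F(ξ,u,v)`, where the derivative of `u` no longer occurs. Conversely,
`coordInv` turns solutions `ξ` into solutions `x`. The work here is `contDiff_vexp`, and through it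
`contDiff_flow`.

The transformed equation makes sense for merely integrable `u`, and its solution depends
continuously on `u` in `L¹` and on the initial value (`tendstoUniformlyOn_isXiSolution`). As `F` is
in general only continuous in the state, this rests on compactness and the assumed uniqueness
(Kamke) rather than on Grönwall.

Uniqueness: if `(u_k, x_k)` are the approximations at `t`, then `φ(x_k,u_k)` converges uniformly to
`ξ`, and `u_k(t) → u(t)` forces `x(t) = Pr (coordInv (ξ(t),u(t)))`. Existence: the same formula
defines `x`. The approximating controls must converge both at `a` and at `t`, whereas an impulse
domain provides one point only; the second is gained by a change of time
(`exists_approx_of_impulseDomain`). -/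

namespace Impulsive

/-! ### Grönwall estimates and global existence under linear growth -/

section ODE

variable {E : Type*} [NormedAddCommGroup E] [NormedSpace ℝ E]

lemma hasDerivWithinAt_Ici_of_Icc {γ : ℝ → E} {γ' : E} {t : ℝ} (ht : t ∈ Ico (0 : ℝ) 1)
    (h : HasDerivWithinAt γ γ' (Icc 0 1) t) : HasDerivWithinAt γ γ' (Ici t) t := by
  refine h.mono_of_mem_nhdsWithin ?_
  refine mem_of_superset (Icc_mem_nhdsGE ht.2) ?_
  exact Icc_subset_Icc_left ht.1

/-- Grönwall's inequality on `[0,1]`, with a simple bound. -/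
lemma norm_le_mul_exp_of_norm_deriv_le {γ γ' : ℝ → E} {K δ ε : ℝ} (hK : 1 ≤ K) (hε : 0 ≤ ε)
    (hγ : ∀ t ∈ Icc (0 : ℝ) 1, HasDerivWithinAt γ (γ' t) (Icc 0 1) t)
    (h0 : ‖γ 0‖ ≤ δ) (hb : ∀ t ∈ Icc (0 : ℝ) 1, ‖γ' t‖ ≤ K * ‖γ t‖ + ε) :
    ∀ t ∈ Icc (0 : ℝ) 1, ‖γ t‖ ≤ (δ + ε) * Real.exp K := by
  intro t ht
  have h := norm_le_gronwallBound_of_norm_deriv_right_le (f := γ) (f' := γ') (δ := δ) (K := K)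
    (ε := ε) (a := 0) (b := 1) (fun t ht => (hγ t ht).continuousWithinAt)
    (fun t ht => hasDerivWithinAt_Ici_of_Icc ht (hγ t (Ico_subset_Icc_self ht))) h0
    (fun t ht => hb t (Ico_subset_Icc_self ht)) t ht
  have hδ : 0 ≤ δ := (norm_nonneg _).trans h0
  refine h.trans ((gronwallBound_mono hδ hε (by linarith) (show t - 0 ≤ 1 by linarith [ht.2])).trans ?_)
  rw [gronwallBound_of_K_ne_0 (by linarith : K ≠ 0)]
  have h1 : ε / K ≤ ε := div_le_self hε hK
  have h2 : 0 ≤ Real.exp K - 1 := by linarith [Real.add_one_le_exp K]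
  have h3 := mul_le_mul_of_nonneg_right h1 h2
  simp only [mul_one]
  nlinarith [Real.exp_pos K]

/-- The radial retraction onto the closed ball of radius `R`. -/
noncomputable def radialRetraction (R : ℝ) (x : E) : E := (R / max R ‖x‖) • x

lemma radialRetraction_of_norm_le {R : ℝ} (hR : 0 < R) {x : E} (hx : ‖x‖ ≤ R) :
    radialRetraction R x = x := by
  rw [radialRetraction, max_eq_left hx, div_self hR.ne', one_smul]

lemma norm_radialRetraction_le {R : ℝ} (hR : 0 < R) (x : E) : ‖radialRetraction R x‖ ≤ R := by
  have h : 0 < max R ‖x‖ := lt_max_of_lt_left hR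
  rw [radialRetraction, norm_smul, Real.norm_of_nonneg (by positivity), div_mul_eq_mul_div,
    div_le_iff₀ h]
  exact mul_le_mul_of_nonneg_left (le_max_right _ _) hR.le

lemma norm_radialRetraction_le_norm {R : ℝ} (hR : 0 < R) (x : E) :
    ‖radialRetraction R x‖ ≤ ‖x‖ := by
  have h : 0 < max R ‖x‖ := lt_max_of_lt_left hR
  rw [radialRetraction, norm_smul, Real.norm_of_nonneg (by positivity)]
  exact mul_le_of_le_one_left (norm_nonneg _) ((div_le_one h).2 (le_max_left _ _))

/-- The difference splits into a contracted copy of `x - y` and a change of scaling factor along the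
shorter vector; each is at most `‖x - y‖`. No inner product is used, since the retraction is also
applied to spaces of operators. -/
lemma lipschitzWith_radialRetraction {R : ℝ} (hR : 0 < R) :
    LipschitzWith 2 (radialRetraction R : E → E) := by
  refine LipschitzWith.of_dist_le_mul ?_
  intro x y
  wlog hxy : ‖x‖ ≤ ‖y‖ generalizing x y
  · rw [dist_comm, dist_comm x]; exact this y x (le_of_not_ge hxy)
  simp only [dist_eq_norm, NNReal.coe_ofNat]
  have hx : 0 < max R ‖x‖ := lt_max_of_lt_left hR
  have hy : 0 < max R ‖y‖ := lt_max_of_lt_left hR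
  have hle : R / max R ‖y‖ ≤ R / max R ‖x‖ :=
    div_le_div_of_nonneg_left hR.le hx (max_le_max le_rfl hxy)
  have h1 : radialRetraction R x - radialRetraction R y
      = (R / max R ‖y‖) • (x - y) + (R / max R ‖x‖ - R / max R ‖y‖) • x := by
    simp only [radialRetraction]; module
  have h2 : ‖(R / max R ‖y‖) • (x - y)‖ ≤ ‖x - y‖ := by
    rw [norm_smul, Real.norm_of_nonneg (by positivity)]
    exact mul_le_of_le_one_left (norm_nonneg _) ((div_le_one hy).2 (le_max_left _ _))
  have h4 : ‖y‖ - ‖x‖ ≤ ‖x - y‖ := by rw [norm_sub_rev]; exact norm_sub_norm_le y x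
  have h3 : ‖(R / max R ‖x‖ - R / max R ‖y‖) • x‖ ≤ ‖x - y‖ := by
    rw [norm_smul, Real.norm_of_nonneg (by linarith)]
    refine le_trans ?_ h4
    rcases le_total ‖y‖ R with hyR | hyR
    · rw [max_eq_left hyR, max_eq_left (hxy.trans hyR)]; simpa using hxy
    · rw [max_eq_right hyR] at hy ⊢
      rcases le_total ‖x‖ R with hxR | hxR
      · rw [max_eq_left hxR, div_self hR.ne', one_sub_div hy.ne', div_mul_eq_mul_div,
          div_le_iff₀ hy]
        nlinarith [norm_nonneg x]
      · rw [max_eq_right hxR] at hx ⊢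
        rw [div_sub_div _ _ hx.ne' hy.ne', div_mul_eq_mul_div, div_le_iff₀ (by positivity)]
        nlinarith [mul_nonneg (mul_nonneg hx.le (sub_nonneg.2 hxR))
          (sub_nonneg.2 hxy), mul_nonneg hx.le (sub_nonneg.2 hxy),
          mul_nonneg (mul_nonneg hx.le (sub_nonneg.2 hyR)) (sub_nonneg.2 hxy)]
  rw [h1]
  linarith [norm_add_le ((R / max R ‖y‖) • (x - y)) ((R / max R ‖x‖ - R / max R ‖y‖) • x)]

/-- A locally Lipschitz time-dependent vector field with linear growth has solutions on `[0,1]`. -/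
theorem exists_solution_of_linear_growth [CompleteSpace E] {f : ℝ → E → E} {C : ℝ}
    (hlip : ∀ R, ∃ K, ∀ t ∈ Icc (0 : ℝ) 1, LipschitzOnWith K (f t) (Metric.closedBall 0 R))
    (hcont : ∀ x, ContinuousOn (fun t => f t x) (Icc 0 1))
    (hgrowth : ∀ t ∈ Icc (0 : ℝ) 1, ∀ x, ‖f t x‖ ≤ C * (1 + ‖x‖)) (p : E) :
    ∃ γ : ℝ → E, γ 0 = p ∧ ∀ t ∈ Icc (0 : ℝ) 1, HasDerivWithinAt γ (f t (γ t)) (Icc 0 1) t := by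
  wlog hC : 1 ≤ C generalizing C
  · refine this (C := 1) (fun t ht x => (hgrowth t ht x).trans ?_) le_rfl
    exact mul_le_mul_of_nonneg_right (le_of_not_ge hC) (by positivity)
  -- The a priori Grönwall bound. The retraction does not increase norms, so the truncated field
  -- obeys the same growth bound; its solution stays in the ball of radius `R` and never sees the
  -- truncation.
  set R : ℝ := (‖p‖ + C) * Real.exp C with hRdef
  have hR : 0 < R := mul_pos (by positivity) (Real.exp_pos _)
  obtain ⟨K, hK⟩ := hlip R
  -- A speed bound for the truncated field. The time length is `1`, so `L` also serves as the radius
  -- of the Picard–Lindelöf ball.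
  set L : NNReal := ⟨C * (1 + R), by positivity⟩
  have hPL : IsPicardLindelof (fun t x => f t (radialRetraction R x))
      (⟨0, by simp⟩ : Icc (0 : ℝ) 1) p L 0 L (K * 2) := by
    refine ⟨fun t ht => ?_, fun x _ => hcont _, fun t ht x _ => ?_, ?_⟩
    · refine (hK t ht).comp (lipschitzWith_radialRetraction hR).lipschitzOnWith ?_
      intro x _
      simpa using norm_radialRetraction_le hR x
    · refine (hgrowth t ht _).trans ?_
      change _ ≤ C * (1 + R)
      have := norm_radialRetraction_le hR x
      gcongr
    · simp
  obtain ⟨γ, h0, hγ⟩ := hPL.exists_eq_forall_mem_Icc_hasDerivWithinAt₀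
  refine ⟨γ, h0, fun t ht => ?_⟩
  have hbound := norm_le_mul_exp_of_norm_deriv_le (δ := ‖p‖) (ε := C) hC (by linarith) hγ
    (by simp only at h0; rw [h0]) (fun t ht => (hgrowth t ht _).trans (by
      have := norm_radialRetraction_le_norm hR (γ t)
      nlinarith)) t ht
  simpa only [radialRetraction_of_norm_le hR hbound] using hγ t ht

variable {h : E → E} {p : E} {γ : ℝ → E} {C : ℝ}

lemma IsIntegralCurve01.norm_le (hγ : IsIntegralCurve01 h p γ)
    (hC : 1 ≤ C) (hgrowth : ∀ x, ‖h x‖ ≤ C * (1 + ‖x‖)) :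
    ∀ t ∈ Icc (0 : ℝ) 1, ‖γ t‖ ≤ (‖p‖ + C) * Real.exp C :=
  norm_le_mul_exp_of_norm_deriv_le hC (by linarith) hγ.2 (by rw [hγ.1])
    (fun t _ => (hgrowth (γ t)).trans (by linarith))

end ODE
-- Differentiability of the time-one flow of a `C¹` field
section ODE

variable {E : Type*} [NormedAddCommGroup E] [NormedSpace ℝ E]

lemma exists_lipschitzOnWith_closedBall [ProperSpace E] {h : E → E} (hh : ContDiff ℝ 1 h) (R : ℝ) :
    ∃ K : NNReal, 1 ≤ K ∧ LipschitzOnWith K h (Metric.closedBall 0 R) ∧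
      ∀ x ∈ Metric.closedBall (0 : E) R, ‖fderiv ℝ h x‖ ≤ K := by
  obtain ⟨M, hM⟩ := (isCompact_closedBall (0 : E) R).exists_bound_of_continuousOn
    (hh.continuous_fderiv one_ne_zero).continuousOn
  refine ⟨max 1 M.toNNReal, le_max_left _ _, ?_, ?_⟩
  · refine (convex_closedBall (0 : E) R).lipschitzOnWith_of_nnnorm_fderiv_le
      (fun x _ => hh.differentiable one_ne_zero x) (fun x hx => ?_)
    exact le_max_of_le_right (NNReal.le_toNNReal_of_coe_le (by simpa using hM x hx))
  · intro x hx
    rw [NNReal.coe_max]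
    exact le_max_of_le_right ((hM x hx).trans (Real.le_coe_toNNReal M))

lemma eqOn_of_linear_ode {A : ℝ → E →L[ℝ] E} {K : ℝ} {y z : ℝ → E}
    (hA : ∀ t ∈ Icc (0 : ℝ) 1, ‖A t‖ ≤ K)
    (hy : ∀ t ∈ Icc (0 : ℝ) 1, HasDerivWithinAt y (A t (y t)) (Icc 0 1) t)
    (hz : ∀ t ∈ Icc (0 : ℝ) 1, HasDerivWithinAt z (A t (z t)) (Icc 0 1) t)
    (h0 : y 0 = z 0) : EqOn y z (Icc 0 1) := by
  intro t ht
  have hb := norm_le_mul_exp_of_norm_deriv_le (K := max 1 K) (δ := 0) (ε := 0) (le_max_left _ _)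
    le_rfl (fun t ht => (hy t ht).sub (hz t ht)) (by simp [h0]) (fun t ht => by
      rw [← map_sub, add_zero]
      refine ((A t).le_opNorm _).trans ?_
      have := (hA t ht).trans (le_max_right 1 K)
      simp only [Pi.sub_apply]
      gcongr) t ht
  rw [add_zero, zero_mul, norm_le_zero_iff] at hb
  simpa [sub_eq_zero] using hb

variable {h : E → E} {p q : E} {γ η : ℝ → E} {C : ℝ}

lemma exists_isIntegralCurve01 [ProperSpace E] (hh : ContDiff ℝ 1 h)
    (hgrowth : ∀ x, ‖h x‖ ≤ C * (1 + ‖x‖)) (p : E) : ∃ γ, IsIntegralCurve01 h p γ :=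
  exists_solution_of_linear_growth (f := fun _ => h) (C := C)
    (fun R => by
      obtain ⟨K, -, hK, -⟩ := exists_lipschitzOnWith_closedBall hh R
      exact ⟨K, fun _ _ => hK⟩) (fun _ => continuousOn_const) (fun _ _ => hgrowth) p

lemma norm_sub_le_of_isIntegralCurve01 {K : NNReal} {s : Set E} (hK1 : 1 ≤ K)
    (hK : LipschitzOnWith K h s) (hγ : IsIntegralCurve01 h p γ) (hη : IsIntegralCurve01 h q η)
    (hγs : ∀ t ∈ Icc (0 : ℝ) 1, γ t ∈ s) (hηs : ∀ t ∈ Icc (0 : ℝ) 1, η t ∈ s) :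
    ∀ t ∈ Icc (0 : ℝ) 1, ‖γ t - η t‖ ≤ ‖p - q‖ * Real.exp K := by
  intro t ht
  have hb := norm_le_mul_exp_of_norm_deriv_le (K := K) (δ := ‖p - q‖) (ε := 0) (by exact_mod_cast hK1)
    le_rfl (fun t ht => (hγ.2 t ht).sub (hη.2 t ht)) (by simp [hγ.1, hη.1]) (fun t ht => by
      simpa [dist_eq_norm] using hK.dist_le_mul _ (hγs t ht) _ (hηs t ht)) t ht
  simpa using hb

lemma IsIntegralCurve01.eqOn [ProperSpace E] (hh : ContDiff ℝ 1 h)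
    (hγ : IsIntegralCurve01 h p γ) (hη : IsIntegralCurve01 h p η) : EqOn γ η (Icc 0 1) := by
  obtain ⟨M, hM⟩ := isCompact_Icc.exists_bound_of_continuousOn
    (fun t ht => (hγ.2 t ht).continuousWithinAt : ContinuousOn γ (Icc 0 1))
  obtain ⟨M', hM'⟩ := isCompact_Icc.exists_bound_of_continuousOn
    (fun t ht => (hη.2 t ht).continuousWithinAt : ContinuousOn η (Icc 0 1))
  obtain ⟨K, hK1, hK, -⟩ := exists_lipschitzOnWith_closedBall hh (max M M')
  intro t ht
  have := norm_sub_le_of_isIntegralCurve01 hK1 hK hγ hη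
    (fun t ht => by simpa using Or.inl (hM t ht)) (fun t ht => by simpa using Or.inr (hM' t ht)) t ht
  rw [sub_self, norm_zero, zero_mul, norm_le_zero_iff] at this
  exact sub_eq_zero.1 this

/-- The first order Taylor estimate of a `C¹` map, uniformly on a closed ball. -/
lemma exists_uniform_taylor [ProperSpace E] (hh : ContDiff ℝ 1 h) (R : ℝ) {ε : ℝ} (hε : 0 < ε) :
    ∃ δ > 0, ∀ x ∈ Metric.closedBall (0 : E) R, ∀ y ∈ Metric.closedBall (0 : E) R,
      ‖x - y‖ < δ → ‖fderiv ℝ h x - fderiv ℝ h y‖ ≤ ε ∧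
        ‖h x - h y - fderiv ℝ h y (x - y)‖ ≤ ε * ‖x - y‖ := by
  have huc := (isCompact_closedBall (0 : E) R).uniformContinuousOn_of_continuous
    (hh.continuous_fderiv one_ne_zero).continuousOn
  obtain ⟨δ, hδ, H⟩ := Metric.uniformContinuousOn_iff.1 huc ε hε
  refine ⟨δ, hδ, fun x hx y hy hxy => ⟨?_, ?_⟩⟩
  · simpa [dist_eq_norm] using (H x hx y hy (by simpa [dist_eq_norm] using hxy)).le
  · have hconv : Convex ℝ (Metric.closedBall (0 : E) R ∩ Metric.ball y δ) :=
      (convex_closedBall _ _).inter (convex_ball _ _)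
    refine hconv.norm_image_sub_le_of_norm_fderiv_le' (𝕜 := ℝ)
      (fun z _ => hh.differentiable one_ne_zero z) (fun z hz => ?_) ⟨hy, by simpa using hδ⟩
      ⟨hx, by simpa [dist_eq_norm] using hxy⟩
    simpa [dist_eq_norm] using (H z hz.1 y hy hz.2).le

/-- The time-one flow of a `C¹` vector field is `C¹`, and its derivative is given by the variational
equation. -/
theorem contDiff_flow [ProperSpace E] (hh : ContDiff ℝ 1 h)
    {Φ : E → ℝ → E} (hΦ : ∀ p, IsIntegralCurve01 h p (Φ p))
    (hbd : ∀ R : ℝ, ∃ R', ∀ q, ‖q‖ ≤ R → ∀ t ∈ Icc (0 : ℝ) 1, ‖Φ q t‖ ≤ R') :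
    ContDiff ℝ 1 (fun p => Φ p 1) ∧ ∀ p e, ∀ w : ℝ → E, w 0 = e →
      (∀ t ∈ Icc (0 : ℝ) 1, HasDerivWithinAt w (fderiv ℝ h (Φ p t) (w t)) (Icc 0 1) t) →
      fderiv ℝ (fun p => Φ p 1) p e = w 1 := by
  have hcontΦ : ∀ p, ContinuousOn (Φ p) (Icc 0 1) :=
    fun p t ht => ((hΦ p).2 t ht).continuousWithinAt
  have hA := hh.continuous_fderiv one_ne_zero
  choose B hB using hbd
  have hball : ∀ R : ℝ, ∀ q, ‖q‖ ≤ R → ∀ t ∈ Icc (0 : ℝ) 1,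
      Φ q t ∈ Metric.closedBall (0 : E) (B R) := fun R q hq t ht => by
    rw [mem_closedBall_zero_iff]
    exact hB R q hq t ht
  -- The fundamental solution of the variational equation along `Φ p`: the candidate for the
  -- derivative of the flow.
  have hY : ∀ p, ∃ Y : ℝ → E →L[ℝ] E, Y 0 = ContinuousLinearMap.id ℝ E ∧
      ∀ t ∈ Icc (0 : ℝ) 1, HasDerivWithinAt Y ((fderiv ℝ h (Φ p t)).comp (Y t)) (Icc 0 1) t := by
    intro p
    obtain ⟨K, hK1, -, hK⟩ := exists_lipschitzOnWith_closedBall hh (B ‖p‖)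
    refine exists_solution_of_linear_growth (C := K)
      (f := fun t (Y : E →L[ℝ] E) => (fderiv ℝ h (Φ p t)).comp Y) ?_ ?_ ?_ _
    · refine fun R => ⟨K, fun t ht => LipschitzOnWith.of_dist_le_mul fun x _ y _ => ?_⟩
      rw [dist_eq_norm, dist_eq_norm, ← ContinuousLinearMap.comp_sub]
      refine (ContinuousLinearMap.opNorm_comp_le _ _).trans ?_
      gcongr
      exact hK _ (hball _ p le_rfl t ht)
    · intro Y
      exact (hA.comp_continuousOn (hcontΦ p)).clm_comp continuousOn_const
    · intro t ht Y
      refine (ContinuousLinearMap.opNorm_comp_le _ _).trans ?_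
      have := hK _ (hball _ p le_rfl t ht)
      gcongr
      linarith
  choose Y hY0 hY using hY
  have hYb : ∀ R : ℝ, ∃ L : ℝ, 0 ≤ L ∧ ∀ q, ‖q‖ ≤ R → ∀ t ∈ Icc (0 : ℝ) 1, ‖Y q t‖ ≤ L := by
    intro R
    obtain ⟨K, hK1, -, hK⟩ := exists_lipschitzOnWith_closedBall hh (B R)
    refine ⟨(1 + 0) * Real.exp K, by positivity, fun q hq => ?_⟩
    refine norm_le_mul_exp_of_norm_deriv_le (by exact_mod_cast hK1) le_rfl (hY q) ?_ ?_
    · rw [hY0]; exact ContinuousLinearMap.norm_id_le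
    · intro t ht
      rw [add_zero]
      refine (ContinuousLinearMap.opNorm_comp_le _ _).trans ?_
      gcongr
      exact hK _ (hball _ q hq t ht)
  -- The flow is Lipschitz in its initial point with constant `exp K` on bounded sets, so the Taylor
  -- estimate of `h` holds along `Φ q` and `Φ p` uniformly in `t`; the divisions by `exp K` absorb
  -- that constant.
  have hclose : ∀ p, ∀ ε > 0, ∃ δ > 0, ∀ q, ‖q - p‖ < δ → ∀ t ∈ Icc (0 : ℝ) 1,
      ‖fderiv ℝ h (Φ q t) - fderiv ℝ h (Φ p t)‖ ≤ ε ∧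
      ‖h (Φ q t) - h (Φ p t) - fderiv ℝ h (Φ p t) (Φ q t - Φ p t)‖ ≤ ε * ‖q - p‖ := by
    intro p ε hε
    obtain ⟨K, hK1, hK, -⟩ := exists_lipschitzOnWith_closedBall hh (B (‖p‖ + 1))
    have he : 1 ≤ Real.exp K := Real.one_le_exp K.2
    obtain ⟨δ, hδ, H⟩ := exists_uniform_taylor hh (B (‖p‖ + 1))
      (ε := ε / Real.exp K) (by positivity)
    refine ⟨min 1 (δ / Real.exp K), by positivity, fun q hq t ht => ?_⟩
    have hq1 : ‖q‖ ≤ ‖p‖ + 1 := by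
      have := norm_le_norm_add_norm_sub' q p
      linarith [hq.trans_le (min_le_left _ _)]
    have hbq := hball _ q hq1
    have hbp := hball (‖p‖ + 1) p (by linarith)
    have hd := norm_sub_le_of_isIntegralCurve01 hK1 hK (hΦ q) (hΦ p) hbq hbp t ht
    have hlt : ‖Φ q t - Φ p t‖ < δ := by
      refine hd.trans_lt ?_
      rw [← lt_div_iff₀ (by positivity)]
      exact hq.trans_le (min_le_right _ _)
    obtain ⟨H1, H2⟩ := H _ (hbq t ht) _ (hbp t ht) hlt
    refine ⟨H1.trans (div_le_self hε.le he), H2.trans ?_⟩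
    calc ε / Real.exp K * ‖Φ q t - Φ p t‖ ≤ ε / Real.exp K * (‖q - p‖ * Real.exp K) := by gcongr
      _ = ε * ‖q - p‖ := by field_simp
  -- The error `Φ q t - Φ p t - Y p t (q - p)` vanishes at `0` and solves the linearised equation up
  -- to a forcing term `o(‖q - p‖)`; Grönwall keeps it `o(‖q - p‖)` up to time `1`.
  have hderiv : ∀ p, HasFDerivAt (fun p => Φ p 1) (Y p 1) p := by
    intro p
    obtain ⟨K, hK1, -, hK⟩ := exists_lipschitzOnWith_closedBall hh (B ‖p‖)
    rw [hasFDerivAt_iff_isLittleO, Asymptotics.isLittleO_iff]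
    intro c hc
    obtain ⟨δ, hδ, H⟩ := hclose p (c / Real.exp K) (by positivity)
    filter_upwards [Metric.ball_mem_nhds p hδ] with q hq
    rw [mem_ball_iff_norm] at hq
    have hb := norm_le_mul_exp_of_norm_deriv_le (K := K) (δ := 0) (ε := c / Real.exp K * ‖q - p‖)
      (γ := fun t => Φ q t - Φ p t - Y p t (q - p))
      (γ' := fun t => h (Φ q t) - h (Φ p t) - fderiv ℝ h (Φ p t) (Y p t (q - p)))
      (by exact_mod_cast hK1) (by positivity)
      (fun t ht => (((hΦ q).2 t ht).sub ((hΦ p).2 t ht)).sub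
        (by simpa using ((hY p t ht).clm_apply (hasDerivWithinAt_const t _ (q - p)))))
      (by simp [(hΦ q).1, (hΦ p).1, hY0]) (fun t ht => by
        have e : h (Φ q t) - h (Φ p t) - fderiv ℝ h (Φ p t) (Y p t (q - p))
            = fderiv ℝ h (Φ p t) (Φ q t - Φ p t - Y p t (q - p)) +
              (h (Φ q t) - h (Φ p t) - fderiv ℝ h (Φ p t) (Φ q t - Φ p t)) := by
          simp only [map_sub]; abel
        rw [e]
        refine (norm_add_le _ _).trans (add_le_add ?_ (H q hq t ht).2)
        refine (ContinuousLinearMap.le_opNorm _ _).trans ?_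
        gcongr
        exact hK _ (hball _ p le_rfl t ht)) 1 (by simp)
    refine hb.trans (le_of_eq ?_)
    field_simp
    ring
  -- `Y q - Y p` solves the linearised equation along `Φ p` with forcing `(Dh(Φ q) - Dh(Φ p)) ∘ Y
  -- q`, small by `hclose` and `hYb`. In the choice of `δ`, `L + 1` guards against `L = 0` and the
  -- factor `2` gives strict inequality.
  have hcontY : Continuous fun p => Y p 1 := by
    refine continuous_iff_continuousAt.2 fun p => Metric.continuousAt_iff.2 fun ε hε => ?_
    obtain ⟨K, hK1, -, hK⟩ := exists_lipschitzOnWith_closedBall hh (B ‖p‖)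
    obtain ⟨L, hL0, hL⟩ := hYb (‖p‖ + 1)
    obtain ⟨δ, hδ, H⟩ := hclose p (ε / (2 * ((L + 1) * Real.exp K))) (by positivity)
    refine ⟨min 1 δ, by positivity, fun q hq => ?_⟩
    rw [dist_eq_norm] at hq ⊢
    have hq1 : ‖q‖ ≤ ‖p‖ + 1 := by
      have := norm_le_norm_add_norm_sub' q p
      linarith [hq.trans_le (min_le_left _ _)]
    have hb := norm_le_mul_exp_of_norm_deriv_le (K := K) (δ := 0)
      (ε := ε / (2 * ((L + 1) * Real.exp K)) * L)
      (γ := fun t => Y q t - Y p t) (by exact_mod_cast hK1) (by positivity)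
      (fun t ht => (hY q t ht).sub (hY p t ht)) (by simp [hY0]) (fun t ht => by
        have e : (fderiv ℝ h (Φ q t)).comp (Y q t) - (fderiv ℝ h (Φ p t)).comp (Y p t)
            = (fderiv ℝ h (Φ p t)).comp (Y q t - Y p t) +
              (fderiv ℝ h (Φ q t) - fderiv ℝ h (Φ p t)).comp (Y q t) := by
          simp only [ContinuousLinearMap.comp_sub, ContinuousLinearMap.sub_comp]; abel
        rw [e]
        refine (norm_add_le _ _).trans (add_le_add ?_ ?_)
        · refine (ContinuousLinearMap.opNorm_comp_le _ _).trans ?_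
          gcongr
          exact hK _ (hball _ p le_rfl t ht)
        · refine (ContinuousLinearMap.opNorm_comp_le _ _).trans ?_
          exact mul_le_mul (H q (hq.trans_le (min_le_right _ _)) t ht).1 (hL q hq1 t ht)
            (norm_nonneg _) (by positivity)) 1 (by simp)
    refine hb.trans_lt ?_
    rw [zero_add, div_mul_eq_mul_div, div_mul_eq_mul_div, div_lt_iff₀ (by positivity)]
    have : 0 < ε * Real.exp K := by positivity
    nlinarith
  have hfd : fderiv ℝ (fun p => Φ p 1) = fun p => Y p 1 := funext fun p => (hderiv p).fderiv
  refine ⟨contDiff_one_iff_fderiv.2 ⟨fun p => (hderiv p).differentiableAt, by rwa [hfd]⟩, ?_⟩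
  intro p e w hw0 hw
  obtain ⟨K, hK1, -, hK⟩ := exists_lipschitzOnWith_closedBall hh (B ‖p‖)
  rw [hfd]
  have heq := eqOn_of_linear_ode (A := fun t => fderiv ℝ h (Φ p t)) (K := K) (y := fun t => Y p t e)
    (fun t ht => hK _ (hball _ p le_rfl t ht))
    (fun t ht => by simpa using ((hY p t ht).clm_apply (hasDerivWithinAt_const t _ e)))
    hw (by simp [hY0, hw0])
  exact heq (right_mem_Icc.2 zero_le_one)

end ODE
-- Straightening the commuting fields
section Coordinates

variable {n m : ℕ} {gt : Fin m → Euc n × Euc m → Euc n} {N : ℝ}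

lemma norm_combG_le (hN : ∀ α p, ‖liftG gt α p‖ ≤ N * (1 + ‖p‖)) (c : Euc m) (p : Euc n × Euc m) :
    ‖combG gt c p‖ ≤ (∑ α, |c α|) * N * (1 + ‖p‖) := by
  refine (norm_sum_le _ _).trans ?_
  rw [Finset.sum_mul, Finset.sum_mul]
  refine Finset.sum_le_sum fun α _ => ?_
  rw [norm_smul, Real.norm_eq_abs, mul_assoc]
  exact mul_le_mul_of_nonneg_left (hN α p) (abs_nonneg _)

lemma contDiff_combG (hg : ∀ α, ContDiff ℝ 1 (liftG gt α)) (c : Euc m) :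
    ContDiff ℝ 1 (combG gt c) := by
  unfold combG
  exact ContDiff.sum fun α _ => (hg α).const_smul (c α)

/-- Uniqueness of integral curves makes the choice in `vexp` immaterial. -/
lemma vexp_eq (hg : ∀ α, ContDiff ℝ 1 (liftG gt α)) {c : Euc m} {p : Euc n × Euc m}
    {γ : ℝ → Euc n × Euc m} (hγ : IsIntegralCurve01 (combG gt c) p γ) :
    vexp (combG gt c) p = γ 1 := by
  have H : ∃ γ, IsIntegralCurve01 (combG gt c) p γ := ⟨γ, hγ⟩
  rw [vexp, dif_pos H]
  exact H.choose_spec.eqOn (contDiff_combG hg c) hγ (by simp)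

lemma combG_snd (c : Euc m) (p : Euc n × Euc m) : (combG gt c p).2 = c := by
  rw [combG, Prod.snd_sum]
  ext i
  simp [liftG, Pi.single_apply]

lemma IsIntegralCurve01.snd_eq {c : Euc m} {p : Euc n × Euc m}
    {γ : ℝ → Euc n × Euc m} (hγ : IsIntegralCurve01 (combG gt c) p γ) :
    (γ 1).2 = p.2 + c := by
  have hd : ∀ t ∈ Icc (0 : ℝ) 1, HasDerivWithinAt (fun t => (γ t).2 - t • c) 0 (Icc 0 1) t := by
    intro t ht
    have h1 : HasDerivWithinAt (fun t => (γ t).2) c (Icc 0 1) t := by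
      have := (hasFDerivAt_snd (𝕜 := ℝ) (p := γ t)).comp_hasDerivWithinAt t (hγ.2 t ht)
      rwa [ContinuousLinearMap.coe_snd', combG_snd] at this
    have h2 : HasDerivWithinAt (fun t : ℝ => t • c) c (Icc 0 1) t := by
      simpa using (hasDerivWithinAt_id t (Icc (0 : ℝ) 1)).smul_const c
    simpa using h1.fun_sub h2
  have h := constant_of_derivWithin_zero (fun t ht => (hd t ht).differentiableWithinAt)
    (fun t ht => (hd t (Ico_subset_Icc_self ht)).derivWithin
      (uniqueDiffOn_Icc zero_lt_one t (Ico_subset_Icc_self ht))) 1 (by simp)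
  simp only [zero_smul, sub_zero, one_smul, hγ.1] at h
  rw [← h]; abel

lemma IsIntegralCurve01.reverse {c : Euc m} {p : Euc n × Euc m}
    {γ : ℝ → Euc n × Euc m} (hγ : IsIntegralCurve01 (combG gt c) p γ) :
    IsIntegralCurve01 (combG gt (-c)) (γ 1) (fun t => γ (1 - t)) := by
  refine ⟨by simp, fun t ht => ?_⟩
  have h1 : (1 - t) ∈ Icc (0 : ℝ) 1 := by constructor <;> linarith [ht.1, ht.2]
  have h2 := (hγ.2 (1 - t) h1).scomp (h := fun s : ℝ => 1 - s) (h' := -1) t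
    (by simpa using (hasDerivWithinAt_id t (Icc (0 : ℝ) 1)).const_sub 1)
    (fun s hs => by constructor <;> linarith [hs.1, hs.2])
  have h3 : combG gt (-c) (γ (1 - t)) = (-1 : ℝ) • combG gt c (γ (1 - t)) := by
    simp [combG]
  rw [h3]
  exact h2

variable (gt) in
/-- The vector field `(p, c) ↦ (c_α g_α(p), 0)`, which has the parameters `c` among its
variables. -/
noncomputable def paramField (q : (Euc n × Euc m) × Euc m) : (Euc n × Euc m) × Euc m :=
  (combG gt q.2 q.1, 0)

lemma hasFDerivAt_paramField (hg : ∀ α, ContDiff ℝ 1 (liftG gt α))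
    (q : (Euc n × Euc m) × Euc m) :
    HasFDerivAt (paramField gt)
      ((∑ α, (q.2 α • (fderiv ℝ (liftG gt α) q.1).comp (ContinuousLinearMap.fst ℝ _ _) +
        ((EuclideanSpace.proj α).comp (ContinuousLinearMap.snd ℝ _ _)).smulRight
          (liftG gt α q.1))).prod 0) q := by
  refine HasFDerivAt.prodMk ?_ (hasFDerivAt_const _ _)
  refine HasFDerivAt.fun_sum fun α _ => ?_
  have h1 : HasFDerivAt (fun q : (Euc n × Euc m) × Euc m => q.2 α)
      ((EuclideanSpace.proj α).comp (ContinuousLinearMap.snd ℝ _ _)) q :=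
    (EuclideanSpace.proj  α : Euc m →L[ℝ] ℝ).hasFDerivAt.comp q hasFDerivAt_snd
  exact h1.smul
    ((((hg α).differentiable one_ne_zero) q.1).hasFDerivAt.comp q hasFDerivAt_fst)

lemma contDiff_paramField (hg : ∀ α, ContDiff ℝ 1 (liftG gt α)) :
    ContDiff ℝ 1 (paramField gt) := by
  refine ContDiff.prodMk (ContDiff.sum fun α _ => ?_) contDiff_const
  have h1 : ContDiff ℝ 1 (fun q : (Euc n × Euc m) × Euc m => q.2 α) :=
    (EuclideanSpace.proj  α : Euc m →L[ℝ] ℝ).contDiff.comp contDiff_snd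
  exact h1.smul ((hg α).comp contDiff_fst)

/-- The flow map `(p, c) ↦ exp(c_α g_α)(p)` is `C¹`, and if the fields `g_α` commute, its
derivative with respect to `c_α` is `g_α`. -/
theorem contDiff_vexp (hg : ∀ α, ContDiff ℝ 1 (liftG gt α))
    (hN0 : 0 ≤ N) (hN : ∀ α p, ‖liftG gt α p‖ ≤ N * (1 + ‖p‖))
    (hcomm : ∀ α β : Fin m, ∀ p : Euc n × Euc m,
      VectorField.lieBracket ℝ (liftG gt α) (liftG gt β) p = 0) :
    ContDiff ℝ 1 (fun q : (Euc n × Euc m) × Euc m => vexp (combG gt q.2) q.1) ∧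
    ∀ p c α, fderiv ℝ (fun q : (Euc n × Euc m) × Euc m => vexp (combG gt q.2) q.1) (p, c)
      (0, EuclideanSpace.single α 1) = liftG gt α (vexp (combG gt c) p) := by
  have hex : ∀ q : (Euc n × Euc m) × Euc m, ∃ γ, IsIntegralCurve01 (combG gt q.2) q.1 γ := fun q =>
    exists_isIntegralCurve01 (contDiff_combG hg _) (norm_combG_le hN q.2) q.1
  choose γ hγ using hex
  have hΦ : ∀ q, IsIntegralCurve01 (paramField gt) q (fun t => (γ q t, q.2)) := fun q =>
    ⟨by simp [(hγ q).1], fun t ht => ((hγ q).2 t ht).prodMk (hasDerivWithinAt_const _ _ _)⟩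
  -- `paramField` is linear in `c`, so its natural growth bound in `(p,c)` is quadratic. But `c` is
  -- constant along the flow, and for `‖c‖ ≤ R` the growth in `p` is linear; this is why
  -- `contDiff_flow` asks for bounds on the flow and not on the field.
  have hbd : ∀ R : ℝ, ∃ R', ∀ q : (Euc n × Euc m) × Euc m, ‖q‖ ≤ R →
      ∀ t ∈ Icc (0 : ℝ) 1, ‖(γ q t, q.2)‖ ≤ R' := by
    intro R
    refine ⟨max ((R + (m * R * N + 1)) * Real.exp (m * R * N + 1)) R, fun q hq t ht => ?_⟩
    have hR : 0 ≤ R := (norm_nonneg _).trans hq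
    have hC : 1 ≤ m * R * N + 1 := by
      have : 0 ≤ m * R * N := by positivity
      linarith
    have hq2 : ‖q.2‖ ≤ R := (norm_snd_le q).trans hq
    have hq1 : ‖q.1‖ ≤ R := (norm_fst_le q).trans hq
    refine max_le_max ?_ hq2
    refine ((hγ q).norm_le hC (fun x => (norm_combG_le hN q.2 x).trans ?_) t ht).trans (by gcongr)
    have hsum : ∑ α, |q.2 α| ≤ m * R := by
      refine (Finset.sum_le_card_nsmul Finset.univ (fun α => |q.2 α|) R fun α _ => ?_).trans
        (by simp)
      exact (PiLp.norm_apply_le q.2 α).trans hq2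
    have : (∑ α, |q.2 α|) * N ≤ m * R * N + 1 := by nlinarith
    gcongr
  obtain ⟨h1, h2⟩ := contDiff_flow (contDiff_paramField hg) hΦ hbd
  have hv : (fun q : (Euc n × Euc m) × Euc m => vexp (combG gt q.2) q.1) = fun q => γ q 1 :=
    funext fun q => vexp_eq hg (hγ q)
  have hv1 : ContDiff ℝ 1 (fun q => γ q 1) := contDiff_fst.comp h1
  rw [hv]
  refine ⟨hv1, fun p c α => ?_⟩
  rw [vexp_eq hg (hγ (p, c))]
  -- The point where commutativity enters: `s ↦ (s g_α(γ(s)), e_α)` solves the variational equation,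
  -- because the vanishing brackets let `Dg_α` applied to `c_β g_β` be replaced by `c_β Dg_β`
  -- applied to `g_α`. Its value at `s = 1` is the derivative sought.
  have h3 := h2 (p, c) (0, EuclideanSpace.single α 1)
    (fun s => (s • liftG gt α (γ (p, c) s), EuclideanSpace.single α 1)) (by simp) ?_
  · have h4 : HasFDerivAt (fun q : (Euc n × Euc m) × Euc m => (γ q 1, q.2))
        ((fderiv ℝ (fun q => γ q 1) (p, c)).prod (ContinuousLinearMap.snd ℝ _ _)) (p, c) :=
      ((hv1.differentiable one_ne_zero) _).hasFDerivAt.prodMk hasFDerivAt_snd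
    rw [h4.fderiv] at h3
    simpa using congrArg Prod.fst h3
  · intro t ht
    rw [(hasFDerivAt_paramField hg _).fderiv]
    have hd : HasDerivWithinAt (fun s => liftG gt α (γ (p, c) s))
        (fderiv ℝ (liftG gt α) (γ (p, c) t) (combG gt c (γ (p, c) t))) (Icc 0 1) t :=
      (((hg α).differentiable one_ne_zero) _).hasFDerivAt.comp_hasDerivWithinAt t
        ((hγ (p, c)).2 t ht)
    have hd2 := ((hasDerivWithinAt_id t (Icc (0 : ℝ) 1)).smul hd).prodMk
      (hasDerivWithinAt_const t (Icc (0 : ℝ) 1) (EuclideanSpace.single α (1 : ℝ) : Euc m))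
    refine hd2.congr_deriv ?_
    have hc : fderiv ℝ (liftG gt α) (γ (p, c) t) (combG gt c (γ (p, c) t)) =
        ∑ β, c β • fderiv ℝ (liftG gt β) (γ (p, c) t) (liftG gt α (γ (p, c) t)) := by
      rw [combG, map_sum]
      refine Finset.sum_congr rfl fun β _ => ?_
      have := hcomm β α (γ (p, c) t)
      rw [VectorField.lieBracket_eq, sub_eq_zero] at this
      rw [map_smul, this]
    ext1
    · simp only [id, hc, ContinuousLinearMap.prod_apply, sum_apply,
        add_apply, smul_apply,
        ContinuousLinearMap.comp_apply, ContinuousLinearMap.smulRight_apply,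
        ContinuousLinearMap.coe_fst', ContinuousLinearMap.coe_snd', 
        Finset.sum_add_distrib, map_smul, Finset.smul_sum, one_smul]
      congr 1
      · exact Finset.sum_congr rfl fun β _ => smul_comm _ _ _
      · simp
    · simp

variable (gt) in
/-- The map `(ξ, ζ) ↦ exp(ζ_α g_α)(ξ, 0)`, inverse to the change of coordinates `phi`. -/
noncomputable def coordInv (q : Euc n × Euc m) : Euc n × Euc m := vexp (combG gt q.2) (q.1, 0)

variable (hg : ∀ α, ContDiff ℝ 1 (liftG gt α)) (hN : ∀ α p, ‖liftG gt α p‖ ≤ N * (1 + ‖p‖))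
include hg hN

lemma vexp_snd (c : Euc m) (p : Euc n × Euc m) : (vexp (combG gt c) p).2 = p.2 + c := by
  obtain ⟨γ, hγ⟩ := exists_isIntegralCurve01 (contDiff_combG hg c) (norm_combG_le hN c) p
  rw [vexp_eq hg hγ, hγ.snd_eq]

lemma vexp_neg_vexp (c : Euc m) (p : Euc n × Euc m) :
    vexp (combG gt (-c)) (vexp (combG gt c) p) = p := by
  obtain ⟨γ, hγ⟩ := exists_isIntegralCurve01 (contDiff_combG hg c) (norm_combG_le hN c) p
  rw [vexp_eq hg hγ, vexp_eq hg hγ.reverse, sub_self, hγ.1]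

lemma coordInv_snd (q : Euc n × Euc m) : (coordInv gt q).2 = q.2 := by
  rw [coordInv, vexp_snd hg hN, zero_add]

lemma phi_coordInv (q : Euc n × Euc m) : phi gt (coordInv gt q) = q := by
  rw [phi, varphi, coordInv_snd hg hN, coordInv, vexp_neg_vexp hg hN]

/-- The flow of `-z_α g_α` from `(x,z)` ends exactly on the slice `z = 0`, and the reversed flow
leads back. -/
lemma coordInv_phi (p : Euc n × Euc m) : coordInv gt (phi gt p) = p := by
  have h0 : ((vexp (combG gt (-p.2)) p).1, (0 : Euc m)) = vexp (combG gt (-p.2)) p := by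
    ext1
    · rfl
    · rw [vexp_snd hg hN, add_neg_cancel]
  simp only [coordInv, phi, varphi]
  rw [h0]
  simpa using vexp_neg_vexp hg hN (-p.2) p

lemma phiInv_eq (q : Euc n × Euc m) : phiInv gt q = coordInv gt q := by
  have hinj : Function.Injective (phi gt) := Function.LeftInverse.injective (coordInv_phi hg hN)
  rw [phiInv]
  conv_lhs => rw [← phi_coordInv hg hN q]
  exact Function.leftInverse_invFun hinj _

/-- Fields independent of `z` are invariant under translations in `z`, so shifting the integral
curve from `(x,0)` by `-z` gives the one from `(x,-z)`, with the same `x`-component. -/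
lemma varphi_neg_of_indep (hind : ∀ α x z z', gt α (x, z) = gt α (x, z')) (x : Euc n) (z : Euc m) :
    varphi gt (x, -z) = (coordInv gt (x, z)).1 := by
  obtain ⟨γ, hγ⟩ := exists_isIntegralCurve01 (contDiff_combG hg z) (norm_combG_le hN z) (x, 0)
  have hγ' : IsIntegralCurve01 (combG gt z) (x, -z) (fun t => γ t - (0, z)) := by
    refine ⟨by simp [hγ.1], fun t ht => ?_⟩
    have : combG gt z (γ t - (0, z)) = combG gt z (γ t) := by
      refine Finset.sum_congr rfl fun α _ => ?_
      have : gt α (γ t - (0, z)) = gt α (γ t) := by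
        have h := hind α (γ t).1 ((γ t).2 - z) (γ t).2
        rwa [show ((γ t).1, (γ t).2 - z) = γ t - (0, z) by ext1 <;> simp] at h
      rw [liftG, liftG, this]
    rw [this]
    exact (hγ.2 t ht).sub_const _
  rw [varphi, coordInv, neg_neg, vexp_eq hg hγ, vexp_eq hg hγ']
  simp

variable (hN0 : 0 ≤ N) (hcomm : ∀ α β : Fin m, ∀ p : Euc n × Euc m,
      VectorField.lieBracket ℝ (liftG gt α) (liftG gt β) p = 0)
include hN0 hcomm

lemma contDiff_phi : ContDiff ℝ 1 (phi gt) :=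
  (contDiff_fst.comp ((contDiff_vexp hg hN0 hN hcomm).1.comp
    (contDiff_id.prodMk contDiff_snd.neg))).prodMk contDiff_snd

lemma contDiff_coordInv : ContDiff ℝ 1 (coordInv gt) :=
  (contDiff_vexp hg hN0 hN hcomm).1.comp
    ((contDiff_fst.prodMk contDiff_const).prodMk contDiff_snd)

lemma fderiv_coordInv_single (q : Euc n × Euc m) (α : Fin m) :
    fderiv ℝ (coordInv gt) q (0, EuclideanSpace.single α 1) = liftG gt α (coordInv gt q) := by
  obtain ⟨h1, h2⟩ := contDiff_vexp hg hN0 hN hcomm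
  have hL : HasFDerivAt (fun q : Euc n × Euc m => ((q.1, (0 : Euc m)), q.2))
      (((ContinuousLinearMap.fst ℝ (Euc n) (Euc m)).prod 0).prod
        (ContinuousLinearMap.snd ℝ (Euc n) (Euc m))) q :=
    (hasFDerivAt_fst.prodMk (hasFDerivAt_const _ _)).prodMk hasFDerivAt_snd
  have h3 := ((h1.differentiable one_ne_zero) ((q.1, 0), q.2)).hasFDerivAt.comp q hL
  have h4 : fderiv ℝ (coordInv gt) q = _ := h3.fderiv
  rw [h4]
  exact h2 (q.1, 0) q.2 α

lemma fderiv_phi_comp_fderiv_coordInv (q : Euc n × Euc m) (e : Euc n × Euc m) :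
    fderiv ℝ (phi gt) (coordInv gt q) (fderiv ℝ (coordInv gt) q e) = e := by
  have h1 := ((contDiff_phi hg hN hN0 hcomm).differentiable one_ne_zero
    (coordInv gt q)).hasFDerivAt.comp q
    ((contDiff_coordInv hg hN hN0 hcomm).differentiable one_ne_zero q).hasFDerivAt
  have h2 : phi gt ∘ coordInv gt = id := funext (phi_coordInv hg hN)
  rw [h2] at h1
  exact (DFunLike.congr_fun (h1.unique (hasFDerivAt_id q)) e)

lemma fderiv_coordInv_comp_fderiv_phi (p : Euc n × Euc m) (e : Euc n × Euc m) :
    fderiv ℝ (coordInv gt) (phi gt p) (fderiv ℝ (phi gt) p e) = e := by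
  have h1 := ((contDiff_coordInv hg hN hN0 hcomm).differentiable one_ne_zero
    (phi gt p)).hasFDerivAt.comp p
    ((contDiff_phi hg hN hN0 hcomm).differentiable one_ne_zero p).hasFDerivAt
  have h2 : coordInv gt ∘ phi gt = id := funext (coordInv_phi hg hN)
  rw [h2] at h1
  exact (DFunLike.congr_fun (h1.unique (hasFDerivAt_id p)) e)

/-- The straightening itself, read off from `fderiv_coordInv_single` through the inverse; it is what
removes the derivative of the control. -/
lemma fderiv_phi_liftG (p : Euc n × Euc m) (α : Fin m) :
    fderiv ℝ (phi gt) p (liftG gt α p) = (0, EuclideanSpace.single α 1) := by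
  have h1 := fderiv_phi_comp_fderiv_coordInv hg hN hN0 hcomm (phi gt p)
    (0, EuclideanSpace.single α 1)
  rwa [fderiv_coordInv_single hg hN hN0 hcomm, coordInv_phi hg hN] at h1

end Coordinates
-- Absolutely continuous functions with vector values
section AbsolutelyContinuous

open AbsolutelyContinuousOnInterval

lemma absolutelyContinuousOnInterval_of_dist_le {X Y Z : Type*} [PseudoMetricSpace X]
    [PseudoMetricSpace Y] [PseudoMetricSpace Z] {f : ℝ → X} {g : ℝ → Y} {h : ℝ → Z} {a b : ℝ} (K : ℝ)
    (hg : AbsolutelyContinuousOnInterval g a b) (hh : AbsolutelyContinuousOnInterval h a b)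
    (H : ∀ x ∈ uIcc a b, ∀ y ∈ uIcc a b,
      dist (f x) (f y) ≤ K * (dist (g x) (g y) + dist (h x) (h y))) :
    AbsolutelyContinuousOnInterval f a b := by
  have h0 := (Tendsto.add hg hh).const_mul K
  rw [add_zero, mul_zero] at h0
  refine squeeze_zero' (Eventually.of_forall fun E => Finset.sum_nonneg fun _ _ => dist_nonneg)
    ?_ h0
  filter_upwards [show ∀ᶠ E in totalLengthFilter ⊓ 𝓟 (disjWithin a b), E ∈ disjWithin a b from
    eventually_inf_principal.mpr (by simp)] with E hE
  rw [← Finset.sum_add_distrib, Finset.mul_sum]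
  exact Finset.sum_le_sum fun i hi => H _ (hE.1 i hi).1 _ (hE.1 i hi).2

lemma absolutelyContinuousOnInterval_of_dist_le_dist {X Y : Type*} [PseudoMetricSpace X]
    [PseudoMetricSpace Y] {f : ℝ → X} {g : ℝ → Y} {a b : ℝ}
    (hg : AbsolutelyContinuousOnInterval g a b)
    (H : ∀ x ∈ uIcc a b, ∀ y ∈ uIcc a b, dist (f x) (f y) ≤ dist (g x) (g y)) :
    AbsolutelyContinuousOnInterval f a b :=
  absolutelyContinuousOnInterval_of_dist_le 1 hg hg fun x hx y hy => by
    linarith [H x hx y hy, dist_nonneg (x := g x) (y := g y)]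

/-- Increments are dominated by those of the real primitive of `‖f‖`. -/
lemma absolutelyContinuousOnInterval_const_add_integral {E : Type*} [NormedAddCommGroup E]
    [NormedSpace ℝ E] {f : ℝ → E} {a b : ℝ} (hf : IntervalIntegrable f volume a b) (c : E) :
    AbsolutelyContinuousOnInterval (fun t => c + ∫ s in a..t, f s) a b := by
  refine absolutelyContinuousOnInterval_of_dist_le_dist
    (hf.norm.absolutelyContinuousOnInterval_intervalIntegral (c := a) left_mem_uIcc)
    fun x hx y hy => ?_
  have hx' := hf.mono_set (uIcc_subset_uIcc_left hx)
  have hy' := hf.mono_set (uIcc_subset_uIcc_left hy)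
  rw [dist_add_left, dist_comm, dist_comm (∫ s in a..x, ‖f s‖), dist_eq_norm, dist_eq_norm,
    intervalIntegral.integral_interval_sub_left hy' hx',
    intervalIntegral.integral_interval_sub_left hy'.norm hx'.norm]
  exact intervalIntegral.norm_integral_le_abs_integral_norm

/-- Monotonicity keeps disjoint intervals disjoint, and the Lipschitz bound controls their total
length; `K + 1` in the proof avoids dividing by zero. -/
lemma _root_.AbsolutelyContinuousOnInterval.comp_monotone {X : Type*} [PseudoMetricSpace X]
    {f : ℝ → X} {a b c d : ℝ} (hf : AbsolutelyContinuousOnInterval f a b) {θ : ℝ → ℝ}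
    (hθ : Monotone θ) {K : NNReal} (hK : LipschitzWith K θ)
    (hmaps : ∀ t ∈ uIcc c d, θ t ∈ uIcc a b) :
    AbsolutelyContinuousOnInterval (f ∘ θ) c d := by
  rw [absolutelyContinuousOnInterval_iff] at hf ⊢
  intro ε hε
  obtain ⟨δ, hδ, H⟩ := hf ε hε
  refine ⟨δ / (K + 1), by positivity, fun E hE hlen => ?_⟩
  refine H (E.1, fun i => (θ (E.2 i).1, θ (E.2 i).2))
    ⟨fun i hi => ⟨hmaps _ (hE.1 i hi).1, hmaps _ (hE.1 i hi).2⟩, fun i hi j hj hij => ?_⟩ ?_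
  · have := hE.2 hi hj hij
    simp only [Function.onFun, uIoc, Ioc_disjoint_Ioc] at this ⊢
    simp only [← hθ.map_min, ← hθ.map_max]
    exact hθ this
  · rw [lt_div_iff₀ (by positivity)] at hlen
    refine lt_of_le_of_lt ?_ hlen
    rw [Finset.sum_mul]
    refine Finset.sum_le_sum fun i _ => (hK.dist_le_mul _ _).trans ?_
    nlinarith [dist_nonneg (x := (E.2 i).1) (y := (E.2 i).2)]

lemma _root_.AbsolutelyContinuousOnInterval.ae_differentiableAt_euclidean {d : ℕ} {f : ℝ → Euc d}
    {a b : ℝ} (hf : AbsolutelyContinuousOnInterval f a b) :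
    ∀ᵐ t, t ∈ uIcc a b → DifferentiableAt ℝ f t := by
  have h : ∀ i : Fin d, ∀ᵐ t, t ∈ uIcc a b → DifferentiableAt ℝ (fun t => f t i) t := fun i =>
    (absolutelyContinuousOnInterval_of_dist_le_dist (f := fun t => f t i) hf
      fun x _ y _ => PiLp.dist_apply_le (f x) (f y) i).ae_differentiableAt
  filter_upwards [ae_all_iff.2 h] with t ht hmem
  exact differentiableAt_euclidean.2 fun i => ht i hmem

lemma _root_.AbsolutelyContinuousOnInterval.eq_add_integral {E : Type*} [NormedAddCommGroup E]
    [NormedSpace ℝ E] [CompleteSpace E] {f w : ℝ → E} {a b : ℝ}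
    (hf : AbsolutelyContinuousOnInterval f a b) (hw : IntervalIntegrable w volume a b)
    (hd : ∀ᵐ t, t ∈ uIcc a b → HasDerivAt f (w t) t) :
    ∀ t ∈ uIcc a b, f t = f a + ∫ s in a..t, w s := by
  obtain ⟨C, hC⟩ := AbsolutelyContinuousOnInterval.const_of_ae_hasDerivAt_zero
    (f := fun t => f t - (0 + ∫ s in a..t, w s))
    (hf.sub (absolutelyContinuousOnInterval_const_add_integral hw 0)) (by
      filter_upwards [hd, hw.ae_hasDerivAt_integral] with t h1 h2 ht
      simpa using (h1 ht).fun_sub (h2 ht a left_mem_uIcc))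
  intro t ht
  have h1 := hC t ht
  have h2 := hC a left_mem_uIcc
  simp only [zero_add, intervalIntegral.integral_same, sub_zero] at h1 h2
  rw [h2, ← h1]; abel

end AbsolutelyContinuous

/-! ### Approximating controls that converge at two points -/

section Approximation

variable {m : ℕ} {U : Set (Euc m)} {a b : ℝ}

lemma IsAC.isL1 {w : ℝ → Euc m} (hab : a ≤ b) (hw : IsAC w a b U) : IsL1 w a b U := by
  refine ⟨?_, hw.2⟩
  have := hw.1.continuousOn
  rw [uIcc_of_le hab] at this
  exact this.integrableOn_compact isCompact_Icc

/-- Extend `u` by the constant `u a` to `[a - 1, a)` and approximate there, with pointwise control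
at `t`. By `L¹` closeness some `s < a` has `w(s)` near `u a`; a change of time taking `a` to `s` and
fixing everything from `a + δ ≤ t` on transports this value to `a`. Values stay in `U`, and
boundedness of `U` makes the cost on `[a, a + δ]` small. -/
lemma exists_approx_of_impulseDomain (hab : a < b) (hU : IsImpulseDomain U)
    (hUb : Bornology.IsBounded U) {u : ℝ → Euc m} (hu : IsL1 u a b U) {t : ℝ} (ht : t ∈ Icc a b)
    {ε : ℝ} (hε : 0 < ε) :
    ∃ w : ℝ → Euc m, IsAC w a b U ∧ ∫ s in Icc a b, ‖w s - u s‖ ≤ ε ∧ ‖w a - u a‖ ≤ ε ∧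
      ‖w t - u t‖ ≤ ε := by
  rcases eq_or_lt_of_le ht.1 with rfl | hat
  · obtain ⟨w, hw, hw1, hwt⟩ := hU a b hab u hu a ht
    have h1 := hw1.2.2.eventually (gt_mem_nhds hε)
    have h2 := (tendsto_iff_norm_sub_tendsto_zero.1 hwt).eventually (gt_mem_nhds hε)
    obtain ⟨k, hk1, hk2⟩ := (h1.and h2).exists
    exact ⟨w k, hw k, hk1.le, hk2.le, hk2.le⟩
  obtain ⟨D, hD0, hD⟩ := hUb.exists_pos_norm_le
  set v : ℝ → Euc m := fun s => if s < a then u a else u s with hv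
  have hvL : IsL1 v (a - 1) b U := by
    constructor
    · have : Icc (a - 1) b = Ico (a - 1) a ∪ Icc a b :=
        (Ico_union_Icc_eq_Icc (by linarith) hab.le).symm
      rw [this]
      refine IntegrableOn.union ?_ ?_
      · refine (integrableOn_const (C := u a) (by simp)).congr_fun (fun s hs => ?_) measurableSet_Ico
        simp [hv, hs.2]
      · refine hu.1.congr_fun (fun s hs => ?_) measurableSet_Icc
        simp [hv, hs.1.not_gt]
    · intro s hs
      by_cases h : s < a
      · simpa [hv, h] using hu.2 a (left_mem_Icc.2 hab.le)
      · simpa [hv, h] using hu.2 s ⟨not_lt.1 h, hs.2⟩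
  obtain ⟨w, hw, hw1, hwt⟩ := hU (a - 1) b (by linarith) v hvL t ⟨by linarith, ht.2⟩
  have h1 := hw1.2.2.eventually (gt_mem_nhds (half_pos hε))
  have h2 := (tendsto_iff_norm_sub_tendsto_zero.1 hwt).eventually (gt_mem_nhds hε)
  obtain ⟨k, hk1, hk2⟩ := (h1.and h2).exists
  have hint : IntegrableOn (fun s => ‖w k s - v s‖) (Icc (a - 1) b) := ((hw1.1 k).sub hvL.1).norm
  -- Otherwise the integral over this interval of length `1` would be at least `ε`, while it is
  -- below `ε / 2`.
  obtain ⟨s, hs, hsε⟩ : ∃ s ∈ Ico (a - 1) a, ‖w k s - u a‖ ≤ ε := by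
    by_contra! hcon
    have hle : ∫ s in Ico (a - 1) a, ε ≤ ∫ s in Ico (a - 1) a, ‖w k s - v s‖ := by
      refine setIntegral_mono_on (integrableOn_const (by simp))
        (hint.mono_set fun s hs => ⟨hs.1, by linarith [hs.2]⟩) measurableSet_Ico fun s hs => ?_
      simpa [hv, hs.2] using (hcon s hs).le
    have hle2 : ∫ s in Ico (a - 1) a, ‖w k s - v s‖ ≤ ∫ s in Icc (a - 1) b, ‖w k s - v s‖ :=
      setIntegral_mono_set hint (ae_of_all _ fun _ => norm_nonneg _)
        (LE.le.eventuallyLE fun s hs => ⟨hs.1, by linarith [hs.2]⟩)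
    simp at hle
    linarith
  -- The first bound makes the time change fix `t`; the second gives `2 * D * δ ≤ ε / 2`.
  set δ : ℝ := min (t - a) (ε / (4 * D)) with hδ
  have hδ0 : 0 < δ := lt_min (by linarith) (by positivity)
  -- The slope of the line through `(a, s)` and `(a + δ, a + δ)`. As `σ ≥ 1`, the minimum defining
  -- `θ` is this line before `a + δ` and the identity after.
  set σ : ℝ := (a + δ - s) / δ with hσ
  have hσ1 : 1 ≤ σ := by rw [hσ, one_le_div hδ0]; linarith [hs.2]
  set θ : ℝ → ℝ := fun τ => min τ (a + δ - σ * (a + δ - τ)) with hθ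
  have hθa : θ a = s := by
    have : a + δ - σ * (a + δ - a) = s := by rw [hσ]; field_simp; ring
    simp only [hθ, this, min_eq_right hs.2.le]
  have hθid : ∀ τ, a + δ ≤ τ → θ τ = τ := fun τ hτ => min_eq_left (by nlinarith)
  have hmono : Monotone θ := by
    refine monotone_id.min fun x y hxy => ?_
    nlinarith
  have hlip : LipschitzWith (max 1 σ.toNNReal) θ := by
    refine LipschitzWith.id.min (LipschitzWith.of_dist_le_mul fun x y => ?_)
    rw [Real.coe_toNNReal _ (by linarith), Real.dist_eq, Real.dist_eq,
      show a + δ - σ * (a + δ - x) - (a + δ - σ * (a + δ - y)) = σ * (x - y) by ring, abs_mul,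
      abs_of_nonneg (by linarith : 0 ≤ σ)]
  have hθmem : ∀ τ ∈ Icc a b, θ τ ∈ Icc (a - 1) b := fun τ hτ =>
    ⟨hs.1.trans (hθa ▸ hmono hτ.1), (min_le_left _ _).trans hτ.2⟩
  have hw' : IsAC (w k ∘ θ) a b U := by
    refine ⟨AbsolutelyContinuousOnInterval.comp_monotone (hw k).1 hmono hlip ?_,
      fun τ hτ => (hw k).2 _ (hθmem τ hτ)⟩
    rwa [uIcc_of_le hab.le, uIcc_of_le (by linarith)]
  have hδt : a + δ ≤ t := by linarith [min_le_left (t - a) (ε / (4 * D))]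
  refine ⟨w k ∘ θ, hw', ?_, ?_, ?_⟩
  · have hsub : Icc a b ⊆ Icc (a - 1) b := Icc_subset_Icc_left (by linarith)
    have hpt : ∀ τ ∈ Icc a b, ‖(w k ∘ θ) τ - u τ‖ ≤
        (Ico a (a + δ)).indicator (fun _ => 2 * D) τ + ‖w k τ - v τ‖ := by
      intro τ hτ
      by_cases h : τ < a + δ
      · rw [indicator_of_mem (show τ ∈ Ico a (a + δ) from ⟨hτ.1, h⟩)]
        have h3 := norm_sub_le ((w k ∘ θ) τ) (u τ)
        linarith [hD _ (hw'.2 τ hτ), hD _ (hu.2 τ hτ), norm_nonneg (w k τ - v τ)]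
      · rw [indicator_of_notMem (fun h' => h h'.2), zero_add, Function.comp_apply,
          hθid τ (not_lt.1 h)]
        simp [hv, hτ.1.not_gt]
    have hind : IntegrableOn ((Ico a (a + δ)).indicator (fun _ => 2 * D)) (Icc a b) :=
      (integrableOn_const (by simp)).indicator measurableSet_Ico
    calc ∫ τ in Icc a b, ‖(w k ∘ θ) τ - u τ‖
        ≤ ∫ τ in Icc a b, ((Ico a (a + δ)).indicator (fun _ => 2 * D) τ + ‖w k τ - v τ‖) :=
          setIntegral_mono_on ((hw'.isL1 hab.le).1.sub hu.1).norm
            (hind.add (hint.mono_set hsub)) measurableSet_Icc hpt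
      _ = (∫ τ in Icc a b, (Ico a (a + δ)).indicator (fun _ => 2 * D) τ) +
          ∫ τ in Icc a b, ‖w k τ - v τ‖ := integral_add hind (hint.mono_set hsub)
      _ ≤ ε / 2 + ε / 2 := by
          refine add_le_add ?_ ?_
          · have hsub' : Ico a (a + δ) ⊆ Icc a b := fun τ hτ =>
              ⟨hτ.1, by linarith [hτ.2, ht.2]⟩
            rw [setIntegral_indicator measurableSet_Ico, inter_eq_self_of_subset_right hsub']
            simp only [setIntegral_const, smul_eq_mul]
            rw [Real.volume_real_Ico_of_le (by linarith), add_sub_cancel_left]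
            have : δ * (4 * D) ≤ ε := (le_div_iff₀ (by positivity)).1 (min_le_right _ _)
            linarith
          · exact (setIntegral_mono_set hint (ae_of_all _ fun _ => norm_nonneg _)
              (LE.le.eventuallyLE hsub)).trans hk1.le
      _ = ε := by ring
  · rwa [Function.comp_apply, hθa]
  · rw [Function.comp_apply, hθid t hδt]
    simpa [hv, ht.1.not_gt] using hk2.le

lemma exists_seq_approx_of_impulseDomain (hab : a < b) (hU : IsImpulseDomain U)
    (hUb : Bornology.IsBounded U) {u : ℝ → Euc m} (hu : IsL1 u a b U) {t : ℝ} (ht : t ∈ Icc a b) :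
    ∃ w : ℕ → ℝ → Euc m, (∀ k, IsAC (w k) a b U) ∧ TendstoL1 w u a b ∧
      Tendsto (fun k => w k a) atTop (𝓝 (u a)) ∧ Tendsto (fun k => w k t) atTop (𝓝 (u t)) := by
  choose w hw h1 ha h2 using fun k : ℕ =>
    exists_approx_of_impulseDomain hab hU hUb hu ht (Nat.one_div_pos_of_nat (α := ℝ) (n := k))
  have h0 := tendsto_one_div_add_atTop_nhds_zero_nat (𝕜 := ℝ)
  refine ⟨w, hw, ⟨fun k => ((hw k).isL1 hab.le).1, hu.1, ?_⟩, ?_, ?_⟩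
  · exact squeeze_zero (fun k => integral_nonneg fun _ => norm_nonneg _) h1 h0
  · exact tendsto_iff_norm_sub_tendsto_zero.2 (squeeze_zero (fun _ => norm_nonneg _) ha h0)
  · exact tendsto_iff_norm_sub_tendsto_zero.2 (squeeze_zero (fun _ => norm_nonneg _) h2 h0)

end Approximation
-- Compactness and Kamke's theorem
section Stability

variable {E : Type*} [NormedAddCommGroup E] {a b : ℝ}

/-- The Arzelà–Ascoli theorem for uniformly Lipschitz sequences on a compact interval. -/
lemma exists_subseq_tendstoUniformlyOn [ProperSpace E] (hab : a ≤ b) {ζ : ℕ → ℝ → E} {B M : ℝ}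
    (hB : ∀ k, ∀ t ∈ Icc a b, ‖ζ k t‖ ≤ B)
    (hM : ∀ k, ∀ s ∈ Icc a b, ∀ t ∈ Icc a b, ‖ζ k s - ζ k t‖ ≤ M * |s - t|) :
    ∃ ψ : ℕ → ℕ, StrictMono ψ ∧ ∃ η : ℝ → E, ContinuousOn η (Icc a b) ∧
      TendstoUniformlyOn (fun k => ζ (ψ k)) η atTop (Icc a b) := by
  have hlip : ∀ k, LipschitzWith M.toNNReal (fun t : Icc a b => ζ k t) := fun k =>
    LipschitzWith.of_dist_le_mul fun s t => by
      rw [dist_eq_norm, Subtype.dist_eq, Real.dist_eq]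
      exact (hM k s s.2 t t.2).trans
        (mul_le_mul_of_nonneg_right (Real.le_coe_toNNReal M) (abs_nonneg _))
  set f : ℕ → BoundedContinuousFunction (Icc a b) E := fun k =>
    BoundedContinuousFunction.mkOfCompact ⟨fun t => ζ k t, (hlip k).continuous⟩ with hf
  have hcomp : IsCompact (closure (range f)) := by
    refine BoundedContinuousFunction.arzela_ascoli (Metric.closedBall 0 B)
      (isCompact_closedBall 0 B) (range f) ?_ ?_
    · rintro _ t ⟨k, rfl⟩
      rw [mem_closedBall_zero_iff]
      exact hB k t t.2
    · refine (LipschitzWith.uniformEquicontinuous _ M.toNNReal ?_).equicontinuous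
      rintro ⟨_, k, rfl⟩
      exact hlip k
  obtain ⟨g, -, ψ, hψ, hlim⟩ := hcomp.tendsto_subseq
    (fun k => subset_closure (mem_range_self (f := f) k))
  refine ⟨ψ, hψ, IccExtend hab g, g.continuous.Icc_extend'.continuousOn, ?_⟩
  rw [BoundedContinuousFunction.tendsto_iff_tendstoUniformly, Metric.tendstoUniformly_iff] at hlim
  rw [Metric.tendstoUniformlyOn_iff]
  intro ε hε
  filter_upwards [hlim ε hε] with k hk t ht
  rw [IccExtend_of_mem hab g ht]
  exact hk ⟨t, ht⟩

/-- If `f` exceeds `c` somewhere, `T` is the first time at which `f` reaches `c`; otherwise `T = b`.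
-/
lemma exists_exit_time (hab : a ≤ b) {f : ℝ → ℝ} (hf : ContinuousOn f (Icc a b)) {c : ℝ}
    (ha : f a ≤ c) : ∃ T ∈ Icc a b, (∀ s ∈ Icc a T, f s ≤ c) ∧ (T = b ∨ f T = c) := by
  by_cases hall : ∀ s ∈ Icc a b, f s ≤ c
  · exact ⟨b, right_mem_Icc.2 hab, hall, Or.inl rfl⟩
  push Not at hall
  obtain ⟨s₀, hs₀, hs₀c⟩ := hall
  set A : Set ℝ := Icc a b ∩ f ⁻¹' Ici c with hA
  have hAc : IsCompact A :=
    isCompact_Icc.of_isClosed_subset (hf.preimage_isClosed_of_isClosed isClosed_Icc isClosed_Ici)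
      inter_subset_left
  have hT : sInf A ∈ A := hAc.sInf_mem ⟨s₀, hs₀, hs₀c.le⟩
  have hlt : ∀ s ∈ Icc a b, c ≤ f s → sInf A ≤ s := fun s hs hc =>
    csInf_le hAc.bddBelow ⟨hs, hc⟩
  have hTc : f (sInf A) = c := by
    refine le_antisymm ?_ hT.2
    by_contra! hgt
    obtain ⟨s, hs, hsc⟩ := intermediate_value_Icc hT.1.1
      (hf.mono (Icc_subset_Icc_right hT.1.2)) ⟨ha, hgt.le⟩
    have := le_antisymm hs.2 (hlt s ⟨hs.1, hs.2.trans hT.1.2⟩ hsc.ge)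
    rw [this] at hsc
    exact hgt.ne' hsc
  refine ⟨sInf A, hT.1, fun s hs => ?_, Or.inr hTc⟩
  by_contra! hgt
  have := le_antisymm hs.2 (hlt s ⟨hs.1, hs.2.trans hT.1.2⟩ hgt.le)
  rw [this, hTc] at hgt
  exact lt_irrefl _ hgt

/-- Kamke's theorem: continuous dependence for ordinary differential equations (in integral form)
under uniqueness of the limit problem. -/
theorem exists_subseq_tendstoUniformlyOn_solution [NormedSpace ℝ E] [ProperSpace E]
    (hab : a < b) {x : ℕ → ℝ → E} {ξ : ℝ → E} {Gk : ℕ → ℝ → E → E} {G : ℝ → E → E}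
    (hint : ∀ k, IntervalIntegrable (fun s => Gk k s (x k s)) volume a b)
    (hx : ∀ k, ∀ t ∈ Icc a b, x k t = x k a + ∫ s in a..t, Gk k s (x k s))
    (hbound : ∀ R : ℝ, ∃ M, ∀ k, ∀ᵐ s, s ∈ Icc a b → ∀ y, ‖y‖ ≤ R → ‖Gk k s y‖ ≤ M)
    (hlim : ∀ᵐ s, s ∈ Icc a b → ∀ (ψ : ℕ → ℕ) (y : ℕ → E) (z : E), Tendsto ψ atTop atTop →
      Tendsto y atTop (𝓝 z) → Tendsto (fun k => Gk (ψ k) s (y k)) atTop (𝓝 (G s z)))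
    (huniq : ∀ T ∈ Icc a b, ∀ η : ℝ → E, ContinuousOn η (Icc a T) →
      (∀ t ∈ Icc a T, η t = ξ a + ∫ s in a..t, G s (η s)) → EqOn η ξ (Icc a T))
    (hξ : ContinuousOn ξ (Icc a b)) (h0 : Tendsto (fun k => x k a) atTop (𝓝 (ξ a))) :
    ∃ ψ : ℕ → ℕ, StrictMono ψ ∧ TendstoUniformlyOn (fun k => x (ψ k)) ξ atTop (Icc a b) := by
  obtain ⟨R, hR⟩ := isCompact_Icc.exists_bound_of_continuousOn hξ
  have haI : a ∈ Icc a b := left_mem_Icc.2 hab.le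
  -- discard the first terms, whose initial values are not controlled
  wlog hinit : ∀ k, ‖x k a‖ ≤ R + 1 generalizing x Gk
  · have hev : ∀ᶠ k in atTop, ‖x k a‖ < R + 1 :=
      h0.norm.eventually (gt_mem_nhds ((hR a haI).trans_lt (lt_add_one R)))
    obtain ⟨k₀, hk₀⟩ := eventually_atTop.1 hev
    obtain ⟨ψ, hψ, h⟩ := this (x := fun k => x (k + k₀)) (Gk := fun k => Gk (k + k₀))
      (fun k => hint _) (fun k => hx _)
      (fun R => let ⟨M, hM⟩ := hbound R; ⟨M, fun k => hM _⟩)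
      (by
        filter_upwards [hlim] with s hs hsI ψ y z hψ hy
        exact hs hsI (fun k => ψ k + k₀) y z ((tendsto_add_atTop_nat k₀).comp hψ) hy)
      (h0.comp (tendsto_add_atTop_nat k₀)) (fun k => (hk₀ _ (Nat.le_add_left _ _)).le)
    exact ⟨fun k => ψ k + k₀, fun i j hij => Nat.add_lt_add_right (hψ hij) _, h⟩
  have hxc : ∀ k, ContinuousOn (x k) (Icc a b) := by
    intro k
    have h := (absolutelyContinuousOnInterval_const_add_integral (hint k) (x k a)).continuousOn
    rw [uIcc_of_le hab.le] at h
    exact h.congr (hx k)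
  obtain ⟨M, hM⟩ := hbound (R + 1)
  choose T hT hTle hTb using fun k => exists_exit_time hab.le (hxc k).norm (hinit k)
  -- No uniform bound on the `x k` is known yet, so each is frozen once its norm reaches `R + 1`.
  -- The frozen curves are bounded and equi-Lipschitz, which yields a limit `η` and a limit `S` of
  -- the stopping times.
  set ζ : ℕ → ℝ → E := fun k t => x k (min t (T k)) with hζ
  have hmin : ∀ k, ∀ t ∈ Icc a b, min t (T k) ∈ Icc a (T k) := fun k t ht =>
    ⟨le_min ht.1 (hT k).1, min_le_right _ _⟩
  have hζB : ∀ k, ∀ t ∈ Icc a b, ‖ζ k t‖ ≤ R + 1 := fun k t ht => hTle k _ (hmin k t ht)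
  have hsub : ∀ k, ∀ t ∈ Icc a (T k), t ∈ Icc a b := fun k t ht => ⟨ht.1, ht.2.trans (hT k).2⟩
  have hII : ∀ k, ∀ s ∈ Icc a b, ∀ t ∈ Icc a b,
      IntervalIntegrable (fun s => Gk k s (x k s)) volume s t := by
    intro k s hs t ht
    refine (hint k).mono_set ?_
    rw [uIcc_of_le hab.le]
    exact uIcc_subset_Icc hs ht
  have hxLip : ∀ k, ∀ s ∈ Icc a (T k), ∀ t ∈ Icc a (T k), ‖x k s - x k t‖ ≤ M * |s - t| := by
    intro k s hs t ht
    rw [hx k s (hsub k s hs), hx k t (hsub k t ht), add_sub_add_left_eq_sub,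
      intervalIntegral.integral_interval_sub_left (hII k a haI s (hsub k s hs))
        (hII k a haI t (hsub k t ht))]
    refine intervalIntegral.norm_integral_le_of_norm_le_const_ae ?_
    filter_upwards [hM k] with r hr hrm
    have hr' : r ∈ Icc a (T k) := uIcc_subset_Icc ht hs (uIoc_subset_uIcc hrm)
    exact hr (hsub k r hr') _ (hTle k r hr')
  have hM0 : 0 ≤ M := by
    by_contra! hneg
    have h1 : ∀ᵐ r, r ∉ Icc a b := (hM 0).mono fun r hr hrI =>
      absurd ((norm_nonneg _).trans (hr hrI _ (hinit 0))) (by linarith)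
    have h2 := measure_eq_zero_iff_ae_notMem.2 h1
    rw [Real.volume_Icc] at h2
    simp only [ENNReal.ofReal_eq_zero] at h2
    linarith
  have hζM : ∀ k, ∀ s ∈ Icc a b, ∀ t ∈ Icc a b, ‖ζ k s - ζ k t‖ ≤ M * |s - t| := by
    intro k s hs t ht
    refine (hxLip k _ (hmin k s hs) _ (hmin k t ht)).trans ?_
    refine mul_le_mul_of_nonneg_left ?_ hM0
    simpa using abs_min_sub_min_le_max s (T k) t (T k)
  obtain ⟨ψ₁, hψ₁, η, hη, hconv₁⟩ := exists_subseq_tendstoUniformlyOn hab.le hζB hζM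
  obtain ⟨S, hS, ψ₂, hψ₂, hTS⟩ := isCompact_Icc.tendsto_subseq (fun k => hT (ψ₁ k))
  set ψ : ℕ → ℕ := fun k => ψ₁ (ψ₂ k) with hψdef
  have hψ : StrictMono ψ := hψ₁.comp hψ₂
  have hconv : TendstoUniformlyOn (fun k => ζ (ψ k)) η atTop (Icc a b) := fun u hu =>
    hψ₂.tendsto_atTop.eventually (hconv₁ u hu)
  have hpt : ∀ t ∈ Icc a b, Tendsto (fun k => ζ (ψ k) t) atTop (𝓝 (η t)) := fun t ht =>
    hconv.tendsto_at ht
  have hηa : η a = ξ a := by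
    refine tendsto_nhds_unique (hpt a haI) ((h0.comp hψ.tendsto_atTop).congr fun k => ?_)
    simp [hζ, min_eq_left (hT (ψ k)).1]
  -- For `t < S` the curves are eventually not yet frozen at `t`, so dominated convergence passes to
  -- the limit in their integral equations. The endpoint `S` is recovered afterwards by continuity.
  have hηeq : ∀ t ∈ Ico a S, η t = ξ a + ∫ s in a..t, G s (η s) := by
    intro t ht
    have htI : t ∈ Icc a b := ⟨ht.1, ht.2.le.trans hS.2⟩
    have hev : ∀ᶠ k in atTop, t < T (ψ k) := hTS.eventually (lt_mem_nhds ht.2)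
    have hsubt : ∀ s ∈ uIoc a t, s ∈ Icc a t := fun s hs => by
      rw [uIoc_of_le ht.1] at hs; exact Ioc_subset_Icc_self hs
    refine tendsto_nhds_unique (hpt t htI) ?_
    have hlim2 : Tendsto (fun k => x (ψ k) a + ∫ s in a..t, Gk (ψ k) s (x (ψ k) s)) atTop
        (𝓝 (ξ a + ∫ s in a..t, G s (η s))) := by
      refine (h0.comp hψ.tendsto_atTop).add ?_
      refine intervalIntegral.tendsto_integral_filter_of_dominated_convergence (fun _ => M)
        (Eventually.of_forall fun k => ?_) ?_ (by simp) ?_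
      · exact (hII (ψ k) a haI t htI).aestronglyMeasurable_restrict_uIoc
      · filter_upwards [hev] with k hk
        filter_upwards [hM (ψ k)] with s hs hst
        have h1 := hsubt s hst
        exact hs ⟨h1.1, h1.2.trans htI.2⟩ _ (hTle _ s ⟨h1.1, h1.2.trans hk.le⟩)
      · filter_upwards [hlim] with s hs hst
        have h1 := hsubt s hst
        have hsI : s ∈ Icc a b := ⟨h1.1, h1.2.trans htI.2⟩
        refine hs hsI ψ _ _ hψ.tendsto_atTop ((hpt s hsI).congr' ?_)
        filter_upwards [hev] with k hk
        simp only [hζ, min_eq_left (h1.2.trans hk.le)]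
    refine hlim2.congr' ?_
    filter_upwards [hev] with k hk
    rw [← hx _ t htI]
    simp only [hζ, min_eq_left hk.le]
  have hηξ : EqOn η ξ (Icc a S) := by
    rcases eq_or_lt_of_le hS.1 with rfl | haS
    · intro t ht
      rw [Icc_self] at ht
      rw [mem_singleton_iff.1 ht, hηa]
    · have h1 : EqOn η ξ (Ico a S) := fun t ht =>
        huniq t ⟨ht.1, ht.2.le.trans hS.2⟩ η
          (hη.mono (Icc_subset_Icc_right (ht.2.le.trans hS.2)))
          (fun r hr => hηeq r ⟨hr.1, hr.2.trans_lt ht.2⟩) (right_mem_Icc.2 ht.1)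
      refine h1.of_subset_closure (hη.mono (Icc_subset_Icc_right hS.2))
        (hξ.mono (Icc_subset_Icc_right hS.2)) Ico_subset_Icc_self ?_
      rw [closure_Ico haS.ne]
  -- Stopping values tend to `η S = ξ S`, of norm at most `R < R + 1`; hence eventually no curve
  -- stops because of its norm, and nothing was frozen.
  have hTev : ∀ᶠ k in atTop, T (ψ k) = b := by
    have h1 : Tendsto (fun k => ζ (ψ k) (T (ψ k))) atTop (𝓝 (η S)) := by
      have h2 : Tendsto (fun k => ζ (ψ k) (T (ψ k)) - ζ (ψ k) S) atTop (𝓝 0) := by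
        refine squeeze_zero_norm (fun k => hζM _ _ (hT _) _ hS) ?_
        have h3 := ((tendsto_iff_norm_sub_tendsto_zero.1 hTS).const_mul M)
        simpa using h3
      simpa using h2.add (hpt S hS)
    have h4 : ‖η S‖ < R + 1 := by
      rw [hηξ (right_mem_Icc.2 hS.1)]
      exact (hR S hS).trans_lt (lt_add_one R)
    filter_upwards [h1.norm.eventually (gt_mem_nhds h4)] with k hk
    rcases hTb (ψ k) with h | h
    · exact h
    · simp only [hζ, min_self] at hk
      exact absurd h hk.ne
  have hSb : S = b := tendsto_nhds_unique hTS
    (tendsto_const_nhds.congr' (hTev.mono fun k hk => hk.symm))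
  rw [hSb] at hηξ
  refine ⟨ψ, hψ, (hconv.congr_right hηξ).congr ?_⟩
  filter_upwards [hTev] with k hk t ht
  simp only [hζ, hk, min_eq_left ht.2]

end Stability
-- Passing between the impulsive system and the transformed one
section Transform

variable {n m l : ℕ} {ft : Euc n × Euc m → Euc l → Euc n} {gt : Fin m → Euc n × Euc m → Euc n}
  {V : Set (Euc l)} {N : ℝ}

/-- Carathéodory-type regularity of a controlled vector field. -/
structure IsCaratheodoryField (F : Euc n × Euc m → Euc l → Euc n) (V : Set (Euc l)) : Prop where
  continuous_left : ∀ v ∈ V, Continuous fun q => F q v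
  continuousOn_right : ∀ q, ContinuousOn (F q) V
  bounded : ∀ R : ℝ, ∃ M, ∀ q, ‖q‖ ≤ R → ∀ v ∈ V, ‖F q v‖ ≤ M

/-- The factor `Dφ` is only continuous, since `φ` is only `C¹`; a Lipschitz `f` therefore yields a
field continuous in the state, and no more is claimed. -/
lemma isCaratheodoryField_Ftilde (hfLip : ∀ v ∈ V, LocallyLipschitz (fun p => liftF ft p v))
    (hfCont : ∀ p, ContinuousOn (liftF ft p) V)
    {M : ℝ} (hM : 0 < M) (hfM : ∀ p, ∀ v ∈ V, ‖liftF ft p v‖ ≤ M * (1 + ‖p‖))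
    (hg : ∀ α, ContDiff ℝ 1 (liftG gt α)) (hN : ∀ α p, ‖liftG gt α p‖ ≤ N * (1 + ‖p‖))
    (hN0 : 0 ≤ N) (hcomm : ∀ α β : Fin m, ∀ p : Euc n × Euc m,
      VectorField.lieBracket ℝ (liftG gt α) (liftG gt β) p = 0) :
    IsCaratheodoryField (Ftilde ft gt) V := by
  have hI : phiInv gt = coordInv gt := funext (phiInv_eq hg hN)
  have hIc := (contDiff_coordInv hg hN hN0 hcomm).continuous
  have hD : Continuous fun q => fderiv ℝ (phi gt) (coordInv gt q) :=
    ((contDiff_phi hg hN hN0 hcomm).continuous_fderiv one_ne_zero).comp hIc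
  refine ⟨fun v hv => ?_, fun q => ?_, fun R => ?_⟩
  · simp only [Ftilde, hI]
    exact (hD.clm_apply ((hfLip v hv).continuous.comp hIc)).fst
  · exact continuous_fst.comp_continuousOn
      ((ContinuousLinearMap.continuous _).comp_continuousOn (hfCont _))
  · obtain ⟨B, hB⟩ := (isCompact_closedBall (0 : Euc n × Euc m) R).exists_bound_of_continuousOn
      hIc.continuousOn
    obtain ⟨L, hL⟩ := (isCompact_closedBall (0 : Euc n × Euc m) R).exists_bound_of_continuousOn
      hD.continuousOn
    refine ⟨L * (M * (1 + B)), fun q hq v hv => ?_⟩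
    have hq' : q ∈ Metric.closedBall (0 : Euc n × Euc m) R := by simpa using hq
    simp only [Ftilde, hI]
    refine (norm_fst_le _).trans ((ContinuousLinearMap.le_opNorm _ _).trans ?_)
    refine mul_le_mul (hL q hq') ((hfM _ v hv).trans ?_) (norm_nonneg _)
      ((norm_nonneg _).trans (hL q hq'))
    have := hB q hq'
    gcongr

lemma _root_.AbsolutelyContinuousOnInterval.comp_contDiff_prodMk {E : Type*} [NormedAddCommGroup E]
    [NormedSpace ℝ E] {Θ : Euc n × Euc m → E} (hΘ : ContDiff ℝ 1 Θ) {a b : ℝ} {x : ℝ → Euc n}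
    {u : ℝ → Euc m} (hx : AbsolutelyContinuousOnInterval x a b)
    (hu : AbsolutelyContinuousOnInterval u a b) :
    AbsolutelyContinuousOnInterval (fun t => Θ (x t, u t)) a b := by
  obtain ⟨B, hB⟩ := isCompact_uIcc.exists_bound_of_continuousOn
    (hx.continuousOn.prodMk hu.continuousOn)
  have hlip : LocallyLipschitzOn (Metric.closedBall (0 : Euc n × Euc m) B) Θ :=
    hΘ.locallyLipschitz.locallyLipschitzOn
  obtain ⟨K, hK⟩ := hlip.exists_lipschitzOnWith_of_compact (isCompact_closedBall _ _)
  refine absolutelyContinuousOnInterval_of_dist_le K hx hu fun s hs t ht => ?_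
  refine (hK.dist_le_mul (x s, u s) (by simpa using hB s hs) (x t, u t)
    (by simpa using hB t ht)).trans ?_
  refine mul_le_mul_of_nonneg_left ?_ K.2
  rw [Prod.dist_eq]
  exact max_le_add_of_nonneg dist_nonneg dist_nonneg

variable (hg : ∀ α, ContDiff ℝ 1 (liftG gt α)) (hN : ∀ α p, ‖liftG gt α p‖ ≤ N * (1 + ‖p‖))
  (hN0 : 0 ≤ N) (hcomm : ∀ α β : Fin m, ∀ p : Euc n × Euc m,
      VectorField.lieBracket ℝ (liftG gt α) (liftG gt β) p = 0)
include hg hN hN0 hcomm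

/-- In the new coordinates, the impulsive system no longer contains the derivative of the
control. -/
lemma IsCaratheodorySolution.isXiSolution {U : Set (Euc m)} {a b : ℝ} (hab : a ≤ b)
    {u : ℝ → Euc m} {v : ℝ → Euc l} {x₀ : Euc n} {x : ℝ → Euc n} (hu : IsAC u a b U)
    (hx : IsCaratheodorySolution ft gt a b u v x₀ x) :
    IsXiSolution ft gt a b u v (varphi gt (x₀, u a)) (fun t => varphi gt (x t, u t)) := by
  have hφ := contDiff_phi hg hN hN0 hcomm
  have hφ1 : ContDiff ℝ 1 (varphi gt) := hφ.fst
  refine ⟨hx.1.comp_contDiff_prodMk hφ1 hu.1, by simp only [hx.2.1], ?_⟩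
  have hud := hu.1.ae_differentiableAt_euclidean
  rw [uIcc_of_le hab, ← ae_restrict_iff' measurableSet_Icc] at hud
  filter_upwards [hx.2.2, hud] with t h1 h2
  have h3 := ((hφ.differentiable one_ne_zero) (x t, u t)).hasFDerivAt.comp_hasDerivAt t
    (h1.prodMk h2.hasDerivAt)
  have h4 : (ft (x t, u t) (v t) + ∑ α, (deriv u t) α • gt α (x t, u t), deriv u t)
      = liftF ft (x t, u t) (v t) + combG gt (deriv u t) (x t, u t) := by
    ext1
    · simp [liftF, combG, liftG, Prod.fst_sum]
    · rw [Prod.snd_add, combG_snd]; simp [liftF]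
  have h5 : phiInv gt (varphi gt (x t, u t), u t) = (x t, u t) :=
    (phiInv_eq hg hN _).trans (coordInv_phi hg hN (x t, u t))
  -- The impulsive part of the velocity is straightened into the `ζ`-directions, hence invisible to
  -- `ξ`.
  have h6 : (fderiv ℝ (phi gt) (x t, u t) (combG gt (deriv u t) (x t, u t))).1 = 0 := by
    rw [combG, map_sum, Prod.fst_sum]
    refine Finset.sum_eq_zero fun α _ => ?_
    rw [map_smul, fderiv_phi_liftG hg hN hN0 hcomm, Prod.smul_fst, smul_zero]
  rw [h4] at h3
  have h7 := hasFDerivAt_fst.comp_hasDerivAt t h3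
  refine h7.congr_deriv ?_
  rw [Ftilde, h5, ContinuousLinearMap.coe_fst', map_add, Prod.fst_add, h6, add_zero]

/-- The converse passage: the derivative of `coordInv` returns `(F, 0)` to `f` and `e_α` to `g_α`,
so the chain rule restores the impulsive terms. -/
lemma IsXiSolution.isCaratheodorySolution {U : Set (Euc m)} {a b : ℝ} (hab : a ≤ b)
    {u : ℝ → Euc m} {v : ℝ → Euc l} {x₀ : Euc n} {ξ : ℝ → Euc n} (hu : IsAC u a b U)
    (hξ : IsXiSolution ft gt a b u v (varphi gt (x₀, u a)) ξ) :
    IsCaratheodorySolution ft gt a b u v x₀ (fun t => (coordInv gt (ξ t, u t)).1) := by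
  have hψ := contDiff_coordInv hg hN hN0 hcomm
  refine ⟨hξ.1.comp_contDiff_prodMk hψ.fst hu.1, ?_, ?_⟩
  · have := coordInv_phi hg hN (x₀, u a)
    rw [phi] at this
    simp only [hξ.2.1, this]
  have hud := hu.1.ae_differentiableAt_euclidean
  rw [uIcc_of_le hab, ← ae_restrict_iff' measurableSet_Icc] at hud
  filter_upwards [hξ.2.2, hud] with t h1 h2
  have h3 := ((hψ.differentiable one_ne_zero) (ξ t, u t)).hasFDerivAt.comp_hasDerivAt t
    (h1.prodMk h2.hasDerivAt)
  set p := coordInv gt (ξ t, u t) with hp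
  have hpe : ((coordInv gt (ξ t, u t)).1, u t) = p := by
    ext1
    · rfl
    · exact (coordInv_snd hg hN (ξ t, u t)).symm
  have hφp : phi gt p = (ξ t, u t) := phi_coordInv hg hN _
  have h4 : (Ftilde ft gt (ξ t, u t) (v t), deriv u t)
      = fderiv ℝ (phi gt) p (liftF ft p (v t)) +
        ∑ α, (deriv u t) α • (0, EuclideanSpace.single α 1) := by
    -- `phi` preserves the `z`-coordinate and `f` has no `z`-component.
    have hs : (fderiv ℝ (phi gt) p (liftF ft p (v t))).2 = 0 := by
      have h := ((contDiff_phi hg hN hN0 hcomm).differentiable one_ne_zero p).hasFDerivAt.snd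
      have h' : fderiv ℝ (fun q : Euc n × Euc m => q.2) p
        = (ContinuousLinearMap.snd ℝ (Euc n) (Euc m)).comp (fderiv ℝ (phi gt) p) := h.fderiv
      rw [show fderiv ℝ (fun q : Euc n × Euc m => q.2) p = ContinuousLinearMap.snd ℝ _ _ from
        fderiv_snd] at h'
      have h'' := DFunLike.congr_fun h' (liftF ft p (v t))
      simpa [liftF] using h''.symm
    ext1
    · rw [Ftilde, phiInv_eq hg hN, ← hp]
      simp [Prod.fst_sum]
    · have := combG_snd (gt := gt) (deriv u t) p
      rw [combG, Prod.snd_sum] at this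
      rw [Prod.snd_add, hs, zero_add, Prod.snd_sum]
      exact this.symm
  have h5 : fderiv ℝ (coordInv gt) (ξ t, u t) (Ftilde ft gt (ξ t, u t) (v t), deriv u t)
      = liftF ft p (v t) + combG gt (deriv u t) p := by
    rw [h4, map_add, ← hφp, fderiv_coordInv_comp_fderiv_phi hg hN hN0 hcomm, map_sum, combG]
    congr 1
    refine Finset.sum_congr rfl fun α _ => ?_
    rw [map_smul, fderiv_coordInv_single hg hN hN0 hcomm, coordInv_phi hg hN]
  rw [h5] at h3
  refine (hasFDerivAt_fst.comp_hasDerivAt t h3).congr_deriv ?_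
  rw [hpe]
  simp [liftF, combG, liftG, Prod.fst_sum]

end Transform
-- The transformed Cauchy problem: integral form, restriction, stability
section Solutions

variable {n m l : ℕ} {ft : Euc n × Euc m → Euc l → Euc n} {gt : Fin m → Euc n × Euc m → Euc n}
  {U : Set (Euc m)} {V : Set (Euc l)} {a b : ℝ}

lemma IsL1ae.nonempty {v : ℝ → Euc l} (hab : a < b) (hv : IsL1ae v a b V) : V.Nonempty := by
  have : NeZero (volume.restrict (Icc a b)) := by
    refine ⟨fun h => ?_⟩
    rw [Measure.restrict_eq_zero, Real.volume_Icc, ENNReal.ofReal_eq_zero] at h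
    linarith
  obtain ⟨t, ht⟩ := hv.2.exists
  exact ⟨_, ht⟩

/-- Nemytskii operators of Carathéodory fields preserve measurability. -/
lemma IsCaratheodoryField.aestronglyMeasurable {F : Euc n × Euc m → Euc l → Euc n}
    (hF : IsCaratheodoryField F V) (hV : IsClosed V) (hVne : V.Nonempty) {μ : Measure ℝ}
    {w : ℝ → Euc n × Euc m} {v : ℝ → Euc l} (hw : AEMeasurable w μ) (hv : AEMeasurable v μ)
    (hvV : ∀ᵐ t ∂μ, v t ∈ V) : AEStronglyMeasurable (fun t => F (w t) (v t)) μ := by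
  classical
  obtain ⟨v₀, hv₀⟩ := hVne
  have hu : Measurable (Function.uncurry fun (q : Euc n × Euc m) (c : V) => F q c) :=
    measurable_uncurry_of_continuous_of_measurable (fun c => hF.continuous_left c c.2)
      (fun q => (continuousOn_iff_continuous_domRestrict.1 (hF.continuousOn_right q)).measurable)
  -- A measurable representative of `v` with all its values in `V`: the field is jointly measurable
  -- only with its control restricted to `V`.
  set c : ℝ → Euc l := fun t => if hv.mk v t ∈ V then hv.mk v t else v₀ with hc
  have hcV : ∀ t, c t ∈ V := fun t => by
    simp only [hc]
    split_ifs with h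
    exacts [h, hv₀]
  have hcm : Measurable c :=
    Measurable.ite (hv.measurable_mk hV.measurableSet) hv.measurable_mk measurable_const
  refine (hu.comp (hw.measurable_mk.prodMk
    (hcm.subtype_mk (h := hcV)))).aestronglyMeasurable.congr ?_
  filter_upwards [hw.ae_eq_mk, hv.ae_eq_mk, hvV] with t h1 h2 h3
  have h4 : c t = v t := by
    rw [h2] at h3
    simp only [hc, if_pos h3, ← h2]
  simp only [Function.comp_apply, Function.uncurry_apply_pair, h4, ← h1]

section Field

variable {F : Euc n × Euc m → Euc l → Euc n} (hF : IsCaratheodoryField F V) (hV : IsCompact V)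
  (hVne : V.Nonempty) (hUb : Bornology.IsBounded U)
include hF hV hVne hUb

lemma IsCaratheodoryField.intervalIntegrable (hab : a ≤ b) {u : ℝ → Euc m} {v : ℝ → Euc l}
    {x : ℝ → Euc n} (hu : IsL1 u a b U) (hv : IsL1ae v a b V) (hx : ContinuousOn x (Icc a b)) :
    IntervalIntegrable (fun t => F (x t, u t) (v t)) volume a b := by
  rw [intervalIntegrable_iff_integrableOn_Icc_of_le hab]
  obtain ⟨B, hB⟩ := isCompact_Icc.exists_bound_of_continuousOn hx
  obtain ⟨D, hD⟩ := hUb.exists_norm_le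
  obtain ⟨M, hM⟩ := hF.bounded (max B D)
  refine IntegrableOn.of_bound (by simp) ?_ M ?_
  · exact hF.aestronglyMeasurable hV.isClosed hVne
      ((hx.aemeasurable measurableSet_Icc).prodMk hu.1.aestronglyMeasurable.aemeasurable)
      hv.1.aestronglyMeasurable.aemeasurable hv.2
  · filter_upwards [hv.2, ae_restrict_mem measurableSet_Icc] with t h1 h2
    refine hM _ ?_ _ h1
    rw [Prod.norm_mk]
    exact max_le_max (hB t h2) (hD _ (hu.2 t h2))

end Field

section Xi

variable (hF : IsCaratheodoryField (Ftilde ft gt) V) (hV : IsCompact V)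
  (hUb : Bornology.IsBounded U) (hab : a < b)
include hF hV hUb hab

lemma IsXiSolution.eq_integral {u : ℝ → Euc m} {v : ℝ → Euc l} {ξ₀ : Euc n} {ξ : ℝ → Euc n}
    (hu : IsL1 u a b U) (hv : IsL1ae v a b V) (hξ : IsXiSolution ft gt a b u v ξ₀ ξ) :
    ContinuousOn ξ (Icc a b) ∧
      IntervalIntegrable (fun s => Ftilde ft gt (ξ s, u s) (v s)) volume a b ∧
      ∀ t ∈ Icc a b, ξ t = ξ a + ∫ s in a..t, Ftilde ft gt (ξ s, u s) (v s) := by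
  have hc := hξ.1.continuousOn
  rw [uIcc_of_le hab.le] at hc
  have hi := hF.intervalIntegrable hV (hv.nonempty hab) hUb hab.le hu hv hc
  refine ⟨hc, hi, ?_⟩
  have h := hξ.1.eq_add_integral hi (by
    rw [uIcc_of_le hab.le, ← ae_restrict_iff' measurableSet_Icc]; exact hξ.2.2)
  rwa [uIcc_of_le hab.le] at h

lemma isXiSolution_of_eq_integral {u : ℝ → Euc m} {v : ℝ → Euc l} {ξ₀ : Euc n} {ξ : ℝ → Euc n}
    (hu : IsL1 u a b U) (hv : IsL1ae v a b V) (hc : ContinuousOn ξ (Icc a b))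
    (hξ : ∀ t ∈ Icc a b, ξ t = ξ₀ + ∫ s in a..t, Ftilde ft gt (ξ s, u s) (v s)) :
    IsXiSolution ft gt a b u v ξ₀ ξ := by
  have hi := hF.intervalIntegrable hV (hv.nonempty hab) hUb hab.le hu hv hc
  refine ⟨?_, by simpa using hξ a (left_mem_Icc.2 hab.le), ?_⟩
  · refine absolutelyContinuousOnInterval_of_dist_le_dist
      (absolutelyContinuousOnInterval_const_add_integral hi ξ₀) fun x hx y hy => ?_
    rw [uIcc_of_le hab.le] at hx hy
    rw [hξ x hx, hξ y hy]
  · rw [← restrict_Ioo_eq_restrict_Icc, ae_restrict_iff' measurableSet_Ioo]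
    filter_upwards [hi.ae_hasDerivAt_integral] with t h1 ht
    have h2 := h1 (by rw [uIcc_of_le hab.le]; exact Ioo_subset_Icc_self ht) a left_mem_uIcc
    refine (h2.const_add ξ₀).congr_of_eventuallyEq ?_
    filter_upwards [Icc_mem_nhds ht.1 ht.2] with s hs using hξ s hs

/-- If the Cauchy problem is uniquely solvable on `[a,b]`, solutions are already unique on shorter
intervals `[a,T]`. -/
lemma eqOn_of_eq_integral
    (hwp : ∀ (ξ₀ : Euc n) (u : ℝ → Euc m) (v : ℝ → Euc l), IsL1 u a b U → IsL1ae v a b V →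
      ∃ ξ, IsXiSolution ft gt a b u v ξ₀ ξ ∧
        ∀ η, IsXiSolution ft gt a b u v ξ₀ η → EqOn η ξ (Icc a b))
    {u : ℝ → Euc m} {v : ℝ → Euc l} (hu : IsL1 u a b U) (hv : IsL1ae v a b V)
    {ξ₀ : Euc n} {ξ : ℝ → Euc n} (hξ : IsXiSolution ft gt a b u v ξ₀ ξ) {T : ℝ} (hT : T ∈ Icc a b)
    {η : ℝ → Euc n} (hc : ContinuousOn η (Icc a T))
    (hη : ∀ t ∈ Icc a T, η t = ξ₀ + ∫ s in a..t, Ftilde ft gt (η s, u s) (v s)) :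
    EqOn η ξ (Icc a T) := by
  obtain ⟨v₀, hv₀⟩ := hv.nonempty hab
  have haI : a ∈ Icc a b := left_mem_Icc.2 hab.le
  -- the controls on `[T,b]`, shifted to `[a,b]`
  set u' : ℝ → Euc m := fun s => (Icc a b).indicator (fun r => u r - u a) (s + (T - a)) + u a
    with hu'
  set v' : ℝ → Euc l := fun s => (Icc a b).indicator (fun r => v r - v₀) (s + (T - a)) + v₀
    with hv'
  have hu'U : IsL1 u' a b U := by
    constructor
    · refine Integrable.add (Integrable.integrableOn ?_) (integrableOn_const (by simp))
      refine Integrable.comp_add_right (f := (Icc a b).indicator (fun r => u r - u a)) ?_ _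
      exact (hu.1.sub (integrableOn_const (by simp))).integrable_indicator measurableSet_Icc
    · intro s _
      by_cases h : s + (T - a) ∈ Icc a b
      · simpa [hu', indicator_of_mem h] using hu.2 _ h
      · simpa [hu', indicator_of_notMem h] using hu.2 a haI
  have hv'V : IsL1ae v' a b V := by
    constructor
    · refine Integrable.add (Integrable.integrableOn ?_) (integrableOn_const (by simp))
      refine Integrable.comp_add_right (f := (Icc a b).indicator (fun r => v r - v₀)) ?_ _
      exact (hv.1.sub (integrableOn_const (by simp))).integrable_indicator measurableSet_Icc
    · have h := (ae_restrict_iff' measurableSet_Icc).1 hv.2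
      refine ae_restrict_of_ae ?_
      filter_upwards [(measurePreserving_add_right volume (T - a)).quasiMeasurePreserving.ae h]
        with s hs
      by_cases h : s + (T - a) ∈ Icc a b
      · simpa [hv', indicator_of_mem h] using hs h
      · simpa [hv', indicator_of_notMem h] using hv₀
  -- Existence on `[a,b]` for the shifted controls continues `η` beyond `T`. The concatenation `χ`
  -- solves the original problem on all of `[a,b]`, where uniqueness is assumed.
  obtain ⟨ζ, hζ, -⟩ := hwp (η T) u' v' hu'U hv'V
  obtain ⟨hζc, hζi, hζe⟩ := hζ.eq_integral hF hV hUb hab hu'U hv'V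
  have hζa : ζ a = η T := hζ.2.1
  set χ : ℝ → Euc n := fun t => η (min t T) + (ζ (max t T - (T - a)) - η T) with hχ
  have hχ1 : ∀ t, t ≤ T → χ t = η t := fun t ht => by
    simp only [hχ, min_eq_left ht, max_eq_right ht, sub_sub_cancel, hζa, sub_self, add_zero]
  have hχ2 : ∀ t, T ≤ t → χ t = ζ (t - (T - a)) := fun t ht => by
    simp only [hχ, min_eq_right ht, max_eq_left ht, add_sub_cancel]
  have hχc : ContinuousOn χ (Icc a b) := by
    refine ContinuousOn.add (hc.comp (by fun_prop) fun t ht => ⟨le_min ht.1 hT.1, min_le_right _ _⟩)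
      (ContinuousOn.sub (hζc.comp (by fun_prop) fun t ht => ?_) continuousOn_const)
    constructor
    · linarith [le_max_right t T]
    · linarith [max_le ht.2 hT.2, hT.1]
  have hχi := hF.intervalIntegrable hV (hv.nonempty hab) hUb hab.le hu hv hχc
  have hχI : ∀ s ∈ Icc a b, ∀ t ∈ Icc a b,
      IntervalIntegrable (fun s => Ftilde ft gt (χ s, u s) (v s)) volume s t := by
    intro s hs t ht
    refine hχi.mono_set ?_
    rw [uIcc_of_le hab.le]
    exact uIcc_subset_Icc hs ht
  have hχe1 : ∀ t ∈ Icc a T, χ t = ξ₀ + ∫ s in a..t, Ftilde ft gt (χ s, u s) (v s) := by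
    intro t ht
    rw [hχ1 t ht.2, hη t ht]
    congr 1
    refine intervalIntegral.integral_congr fun s hs => ?_
    rw [uIcc_of_le ht.1] at hs
    simp only [hχ1 s (hs.2.trans ht.2)]
  have hχsol : IsXiSolution ft gt a b u v ξ₀ χ := by
    refine isXiSolution_of_eq_integral hF hV hUb hab hu hv hχc fun t ht => ?_
    rcases le_total t T with htT | hTt
    · exact hχe1 t ⟨ht.1, htT⟩
    · rw [← intervalIntegral.integral_add_adjacent_intervals (hχI a haI T hT) (hχI T hT t ht),
        ← add_assoc, ← hχe1 T (right_mem_Icc.2 hT.1), hχ2 t hTt, hχ1 T le_rfl,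
        hζe _ ⟨by linarith, by linarith [hT.1, ht.2]⟩, hζa]
      congr 1
      have h := intervalIntegral.integral_comp_sub_right
        (fun s => Ftilde ft gt (ζ s, u' s) (v' s)) (T - a) (a := T) (b := t)
      rw [sub_sub_cancel] at h
      rw [← h]
      refine intervalIntegral.integral_congr fun s hs => ?_
      rw [uIcc_of_le hTt] at hs
      have hsI : s ∈ Icc a b := ⟨hT.1.trans hs.1, hs.2.trans ht.2⟩
      simp only [hu', hv', sub_add_cancel, indicator_of_mem hsI, hχ2 s hs.1]
  obtain ⟨ξ', -, hξ'⟩ := hwp ξ₀ u v hu hv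
  intro t ht
  have htI : t ∈ Icc a b := ⟨ht.1, ht.2.trans hT.2⟩
  rw [← hχ1 t ht.2, hξ' χ hχsol htI, hξ' ξ hξ htI]

omit hF hV hUb hab in
lemma TendstoL1.exists_subseq_tendsto_ae {d : ℕ} {w : ℕ → ℝ → Euc d} {y : ℝ → Euc d}
    (h : TendstoL1 w y a b) : ∃ ψ : ℕ → ℕ, StrictMono ψ ∧
      ∀ᵐ t ∂(volume.restrict (Icc a b)), Tendsto (fun k => w (ψ k) t) atTop (𝓝 (y t)) := by
  refine TendstoInMeasure.exists_seq_tendsto_ae (tendstoInMeasure_of_tendsto_eLpNorm one_ne_zero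
    (fun k => (h.1 k).aestronglyMeasurable) h.2.1.aestronglyMeasurable ?_)
  have h1 := ENNReal.tendsto_ofReal h.2.2
  rw [ENNReal.ofReal_zero] at h1
  refine h1.congr fun k => ?_
  rw [eLpNorm_one_eq_lintegral_enorm]
  exact ofReal_integral_norm_eq_lintegral_enorm ((h.1 k).sub h.2.1)

omit hF hV hUb hab in
lemma TendstoL1.comp {d : ℕ} {w : ℕ → ℝ → Euc d} {y : ℝ → Euc d}
    (h : TendstoL1 w y a b) {ψ : ℕ → ℕ} (hψ : StrictMono ψ) :
    TendstoL1 (fun k => w (ψ k)) y a b :=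
  ⟨fun _ => h.1 _, h.2.1, h.2.2.comp hψ.tendsto_atTop⟩

/-- Stability of the transformed system with respect to `L¹` convergence of the control. -/
theorem tendstoUniformlyOn_isXiSolution
    (hwp : ∀ (ξ₀ : Euc n) (u : ℝ → Euc m) (v : ℝ → Euc l), IsL1 u a b U → IsL1ae v a b V →
      ∃ ξ, IsXiSolution ft gt a b u v ξ₀ ξ ∧
        ∀ η, IsXiSolution ft gt a b u v ξ₀ η → EqOn η ξ (Icc a b))
    {u : ℝ → Euc m} {uk : ℕ → ℝ → Euc m} {v : ℝ → Euc l} (hu : IsL1 u a b U)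
    (huk : ∀ k, IsL1 (uk k) a b U) (hv : IsL1ae v a b V) (hlim : TendstoL1 uk u a b)
    {ξ₀ : Euc n} {ξ : ℝ → Euc n} (hξ : IsXiSolution ft gt a b u v ξ₀ ξ)
    {ξ₀k : ℕ → Euc n} {ξk : ℕ → ℝ → Euc n}
    (hξk : ∀ k, IsXiSolution ft gt a b (uk k) v (ξ₀k k) (ξk k))
    (h0 : Tendsto ξ₀k atTop (𝓝 ξ₀)) :
    TendstoUniformlyOn ξk ξ atTop (Icc a b) := by
  rw [Metric.tendstoUniformlyOn_iff]
  -- Otherwise some subsequence stays `ε`-far from `ξ`. Along a further one the controls converge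
  -- almost everywhere, and Kamke's theorem extracts from it a sequence converging uniformly to `ξ`.
  by_contra! hcon
  obtain ⟨ε, hε, hfr⟩ := hcon
  obtain ⟨ψ₀, hψ₀, hfar⟩ := extraction_of_frequently_atTop hfr
  obtain ⟨ψ₁, hψ₁, hae⟩ := (hlim.comp hψ₀).exists_subseq_tendsto_ae
  set ψ : ℕ → ℕ := fun k => ψ₀ (ψ₁ k) with hψdef
  have hψ : StrictMono ψ := hψ₀.comp hψ₁
  have hint := fun k => (hξk k).eq_integral hF hV hUb hab (huk k) hv
  obtain ⟨hξc, -, hξe⟩ := hξ.eq_integral hF hV hUb hab hu hv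
  have hvV := (ae_restrict_iff' measurableSet_Icc).1 hv.2
  have hae' := (ae_restrict_iff' measurableSet_Icc).1 hae
  obtain ⟨D, hD⟩ := hUb.exists_norm_le
  obtain ⟨ψ₂, hψ₂, hunif⟩ := exists_subseq_tendstoUniformlyOn_solution hab
    (x := fun k => ξk (ψ k)) (ξ := ξ)
    (Gk := fun k s y => Ftilde ft gt (y, uk (ψ k) s) (v s))
    (G := fun s y => Ftilde ft gt (y, u s) (v s))
    (fun k => (hint _).2.1) (fun k => (hint _).2.2)
    (fun R => by
      obtain ⟨M, hM⟩ := hF.bounded (max R D)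
      refine ⟨M, fun k => ?_⟩
      filter_upwards [hvV] with s hs hsI y hy
      refine hM _ ?_ _ (hs hsI)
      rw [Prod.norm_mk]
      exact max_le_max hy (hD _ ((huk _).2 s hsI)))
    (by
      filter_upwards [hvV, hae'] with s hs1 hs2 hsI φ y z hφ hy
      exact ((hF.continuous_left _ (hs1 hsI)).tendsto (z, u s)).comp
        (hy.prodMk_nhds ((hs2 hsI).comp hφ)))
    (fun T hT η hηc hη => eqOn_of_eq_integral hF hV hUb hab hwp hu hv hξ hT hηc
      (by rwa [hξ.2.1] at hη)) hξc
    (by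
      rw [hξ.2.1]
      refine (h0.comp hψ.tendsto_atTop).congr fun k => (hξk _).2.1.symm)
  obtain ⟨k, hk⟩ := ((Metric.tendstoUniformlyOn_iff.1 hunif) ε hε).exists
  obtain ⟨t, ht, hle⟩ := hfar (ψ₁ (ψ₂ k))
  exact absurd (hk t ht) hle.not_gt

end Xi

end Solutions
-- Pointwise defined solutions
section PDSolutions

variable {n m l : ℕ} {ft : Euc n × Euc m → Euc l → Euc n} {gt : Fin m → Euc n × Euc m → Euc n}
  {U : Set (Euc m)} {V : Set (Euc l)} {a b N : ℝ} {u : ℝ → Euc m} {v : ℝ → Euc l} {x₀ : Euc n}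
  {ξ : ℝ → Euc n}

variable (hg : ∀ α, ContDiff ℝ 1 (liftG gt α)) (hN : ∀ α p, ‖liftG gt α p‖ ≤ N * (1 + ‖p‖))
  (hN0 : 0 ≤ N) (hcomm : ∀ α β : Fin m, ∀ p : Euc n × Euc m,
      VectorField.lieBracket ℝ (liftG gt α) (liftG gt β) p = 0)
  (hF : IsCaratheodoryField (Ftilde ft gt) V) (hV : IsCompact V)
  (hUb : Bornology.IsBounded U) (hab : a < b)
  (hwp : ∀ (ξ₀ : Euc n) (u : ℝ → Euc m) (v : ℝ → Euc l), IsL1 u a b U → IsL1ae v a b V →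
      ∃ ξ, IsXiSolution ft gt a b u v ξ₀ ξ ∧
        ∀ η, IsXiSolution ft gt a b u v ξ₀ η → EqOn η ξ (Icc a b))
  (hu : IsL1 u a b U) (hv : IsL1ae v a b V)
  (hξ : IsXiSolution ft gt a b u v (varphi gt (x₀, u a)) ξ)
include hg hN hN0 hcomm hF hV hUb hab hwp hu hv hξ

/-- The initial values `φ(x₀, u_k(a))` converge because `u_k(a) → u(a)`: this is the role of that
condition in the definition of p.d. solutions. -/
lemma tendstoUniformlyOn_of_tendstoL1 {uk : ℕ → ℝ → Euc m} (huk : ∀ k, IsAC (uk k) a b U)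
    (hlim : TendstoL1 uk u a b) (ha : Tendsto (fun k => uk k a) atTop (𝓝 (u a)))
    {ξk : ℕ → ℝ → Euc n}
    (hξk : ∀ k, IsXiSolution ft gt a b (uk k) v (varphi gt (x₀, uk k a)) (ξk k)) :
    TendstoUniformlyOn ξk ξ atTop (Icc a b) := by
  refine tendstoUniformlyOn_isXiSolution hF hV hUb hab hwp hu (fun k => (huk k).isL1 hab.le) hv hlim
    hξ hξk ?_
  exact ((contDiff_phi hg hN hN0 hcomm).continuous.fst.tendsto (x₀, u a)).comp
    (tendsto_const_nhds.prodMk_nhds ha)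

/-- Pointwise defined solutions are obtained from the solution of the transformed system. -/
lemma IsPDSolution.eqOn {y : ℝ → Euc n} (hy : IsPDSolution ft gt U a b u v x₀ y) :
    EqOn y (fun t => (coordInv gt (ξ t, u t)).1) (Icc a b) := by
  intro t ht
  obtain ⟨uk, yk, huk, hlim, ha, hut, hyk, -, -, hyt⟩ := hy t ht
  have hunif := tendstoUniformlyOn_of_tendstoL1 hg hN hN0 hcomm hF hV hUb hab hwp hu hv hξ huk hlim
    ha (fun k => (hyk k).isXiSolution hg hN hN0 hcomm hab.le (huk k))
  refine tendsto_nhds_unique hyt ?_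
  have h1 := ((contDiff_coordInv hg hN hN0 hcomm).continuous.fst.tendsto (ξ t, u t)).comp
    ((hunif.tendsto_at ht).prodMk_nhds hut)
  refine h1.congr fun k => ?_
  exact congrArg Prod.fst (coordInv_phi hg hN (yk k t, uk k t))

/-- Existence of the pointwise defined solution. -/
lemma isPDSolution_coordInv (hU : IsImpulseDomain U) :
    IsPDSolution ft gt U a b u v x₀ (fun t => (coordInv gt (ξ t, u t)).1) := by
  intro t ht
  obtain ⟨w, hw, hwlim, hwa, hwt⟩ := exists_seq_approx_of_impulseDomain hab hU hUb hu ht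
  -- Almost everywhere convergence of the controls gives that of the `x_k`, hence `L¹` convergence
  -- by domination.
  obtain ⟨ψ, hψ, hae⟩ := hwlim.exists_subseq_tendsto_ae
  choose ζ hζ _ using fun k => hwp (varphi gt (x₀, w (ψ k) a)) (w (ψ k)) v
    ((hw (ψ k)).isL1 hab.le) hv
  have hunif := tendstoUniformlyOn_of_tendstoL1 hg hN hN0 hcomm hF hV hUb hab hwp hu hv hξ
    (fun k => hw (ψ k)) (hwlim.comp hψ) (hwa.comp hψ.tendsto_atTop) hζ
  -- Dropping the first `k₀` terms keeps every `ζ` within distance `1` of `ξ`, which provides the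
  -- uniform bound on the `x_k`.
  obtain ⟨k₀, hk₀⟩ := eventually_atTop.1 (Metric.tendstoUniformlyOn_iff.1 hunif 1 one_pos)
  have hshift : StrictMono fun k => k + k₀ := fun i j hij => Nat.add_lt_add_right hij _
  have hψ' : StrictMono fun k => ψ (k + k₀) := hψ.comp hshift
  have hcI := (contDiff_coordInv hg hN hN0 hcomm).continuous
  have hξc := (hξ.eq_integral hF hV hUb hab hu hv).1
  obtain ⟨B, hB⟩ := isCompact_Icc.exists_bound_of_continuousOn hξc
  obtain ⟨D, hD⟩ := hUb.exists_norm_le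
  obtain ⟨C, hC⟩ := (isCompact_closedBall (0 : Euc n × Euc m)
    (max (B + 1) D)).exists_bound_of_continuousOn hcI.continuousOn
  have hbd : ∀ y : Euc n, ∀ z ∈ U, ‖y‖ ≤ B + 1 → ‖(coordInv gt (y, z)).1‖ ≤ C := by
    intro y z hz hy
    refine (norm_fst_le _).trans (hC _ ?_)
    rw [mem_closedBall_zero_iff, Prod.norm_mk]
    exact max_le_max hy (hD z hz)
  have hkbd : ∀ k, ∀ s ∈ Icc a b,
      ‖(coordInv gt (ζ (k + k₀) s, w (ψ (k + k₀)) s)).1‖ ≤ C := by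
    intro k s hs
    refine hbd _ _ ((hw _).2 s hs) ?_
    have h1 := hk₀ (k + k₀) (Nat.le_add_left _ _) s hs
    rw [dist_comm, dist_eq_norm] at h1
    have h2 := norm_le_norm_add_norm_sub' (ζ (k + k₀) s) (ξ s)
    linarith [hB s hs]
  have hsol : ∀ k, IsCaratheodorySolution ft gt a b (w (ψ (k + k₀))) v x₀
      (fun s => (coordInv gt (ζ (k + k₀) s, w (ψ (k + k₀)) s)).1) := fun k =>
    (hζ (k + k₀)).isCaratheodorySolution hg hN hN0 hcomm hab.le (hw _)
  have hpt : ∀ s ∈ Icc a b, Tendsto (fun k => w (ψ (k + k₀)) s) atTop (𝓝 (u s)) →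
      Tendsto (fun k => (coordInv gt (ζ (k + k₀) s, w (ψ (k + k₀)) s)).1) atTop
        (𝓝 (coordInv gt (ξ s, u s)).1) := fun s hs hws =>
    (hcI.fst.tendsto (ξ s, u s)).comp
      (((hunif.tendsto_at hs).comp hshift.tendsto_atTop).prodMk_nhds hws)
  have hxk : ∀ k, IntegrableOn (fun s => (coordInv gt (ζ (k + k₀) s, w (ψ (k + k₀)) s)).1)
      (Icc a b) := fun k => by
    have h := (hsol k).1.continuousOn
    rw [uIcc_of_le hab.le] at h
    exact h.integrableOn_compact isCompact_Icc
  have hx : IntegrableOn (fun s => (coordInv gt (ξ s, u s)).1) (Icc a b) := by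
    refine IntegrableOn.of_bound (by simp) ?_ C ?_
    · exact hcI.fst.comp_aestronglyMeasurable
        ((hξc.aestronglyMeasurable measurableSet_Icc).prodMk hu.1.aestronglyMeasurable)
    · filter_upwards [ae_restrict_mem measurableSet_Icc] with s hs
      exact hbd _ _ (hu.2 s hs) ((hB s hs).trans (by linarith))
  refine ⟨fun k => w (ψ (k + k₀)), fun k s => (coordInv gt (ζ (k + k₀) s, w (ψ (k + k₀)) s)).1,
    fun k => hw _, hwlim.comp hψ', hwa.comp hψ'.tendsto_atTop, hwt.comp hψ'.tendsto_atTop, hsol,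
    ⟨C, hkbd⟩, ⟨hxk, hx, ?_⟩, hpt t ht (hwt.comp hψ'.tendsto_atTop)⟩
  have hdom := tendsto_integral_of_dominated_convergence (μ := volume.restrict (Icc a b))
    (F := fun k s => ‖(coordInv gt (ζ (k + k₀) s, w (ψ (k + k₀)) s)).1 -
      (coordInv gt (ξ s, u s)).1‖) (f := fun _ => (0 : ℝ)) (fun _ => C + C)
    (fun k => ((hxk k).sub hx).aestronglyMeasurable.norm) (integrable_const _)
    (fun k => by
      filter_upwards [ae_restrict_mem measurableSet_Icc] with s hs
      rw [norm_norm]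
      exact (norm_sub_le _ _).trans (add_le_add (hkbd k s hs)
        (hbd _ _ (hu.2 s hs) ((hB s hs).trans (by linarith)))))
    (by
      filter_upwards [ae_restrict_mem measurableSet_Icc, hae] with s hs hs'
      exact tendsto_iff_norm_sub_tendsto_zero.1 (hpt s hs (hs'.comp hshift.tendsto_atTop)))
  simpa using hdom

end PDSolutions

end Impulsive

/-! ### The main theorem -/

open Impulsive in
theorem theorem1 {n m l : ℕ}
    (ft : Euc n × Euc m → Euc l → Euc n) (gt : Fin m → Euc n × Euc m → Euc n)
    (U : Set (Euc m)) (V : Set (Euc l)) (a b : ℝ) (hab : a < b)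
    -- commutativity
    (hcomm : ∀ α β : Fin m, ∀ p : Euc n × Euc m,
      VectorField.lieBracket ℝ (liftG gt α) (liftG gt β) p = 0)
    -- structural hypotheses on the data
    (hV : IsCompact V)
    (hfLip : ∀ v ∈ V, LocallyLipschitz (fun p => liftF ft p v))
    (hfCont : ∀ p, ContinuousOn (liftF ft p) V)
    (hfGrowth : ∃ M > 0, ∀ p, ∀ v ∈ V, ‖liftF ft p v‖ ≤ M * (1 + ‖p‖))
    (hgC1 : ∀ α, ContDiff ℝ 1 (liftG gt α))
    (hgGrowth : ∃ N > 0, ∀ α p, ‖liftG gt α p‖ ≤ N * (1 + ‖p‖))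
    -- the set of values of the impulsive control
    (hU : IsImpulseDomain U) (hUb : Bornology.IsBounded U)
    -- standing assumption: the transformed Cauchy problem is uniquely solvable on `[a,b]`
    (hwp : ∀ (ξ₀ : Euc n) (u : ℝ → Euc m) (v : ℝ → Euc l), IsL1 u a b U → IsL1ae v a b V →
      ∃ ξ, IsXiSolution ft gt a b u v ξ₀ ξ ∧
        ∀ η, IsXiSolution ft gt a b u v ξ₀ η → EqOn η ξ (Icc a b))
    -- initial point and controls
    (x₀ : Euc n) (u : ℝ → Euc m) (v : ℝ → Euc l) (hu : IsL1 u a b U) (hv : IsL1ae v a b V) :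
    ∃ x ξ : ℝ → Euc n,
      -- existence and uniqueness of the p.d. solution on `[a,b]`
      IsPDSolution ft gt U a b u v x₀ x ∧
      (∀ y, IsPDSolution ft gt U a b u v x₀ y → EqOn y x (Icc a b)) ∧
      -- `ξ` is the Carathéodory solution of the transformed problem
      IsXiSolution ft gt a b u v (varphi gt (x₀, u a)) ξ ∧
      (∀ η, IsXiSolution ft gt a b u v (varphi gt (x₀, u a)) η → EqOn η ξ (Icc a b)) ∧
      -- representation
      (∀ t ∈ Icc a b, phi gt (x t, u t) = (ξ t, u t) ∧ (x t, u t) = phiInv gt (ξ t, u t) ∧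
        x t = (vexp (combG gt (u t)) (ξ t, 0)).1) ∧
      ((∀ α x z z', gt α (x, z) = gt α (x, z')) →
        ∀ t ∈ Icc a b, x t = varphi gt (ξ t, -u t)) := by
  obtain ⟨M, hM, hfM⟩ := hfGrowth
  obtain ⟨N, hN, hgN⟩ := hgGrowth
  have hF := isCaratheodoryField_Ftilde hfLip hfCont hM hfM hgC1 hgN hN.le hcomm
  obtain ⟨ξ, hξ, hξu⟩ := hwp (varphi gt (x₀, u a)) u v hu hv
  have hpair : ∀ t, ((coordInv gt (ξ t, u t)).1, u t) = coordInv gt (ξ t, u t) := fun t => by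
    ext1
    · rfl
    · exact (coordInv_snd hgC1 hgN (ξ t, u t)).symm
  have hx := isPDSolution_coordInv hgC1 hgN hN.le hcomm hF hV hUb hab hwp hu hv hξ hU
  refine ⟨fun t => (coordInv gt (ξ t, u t)).1, ξ, hx, fun y hy => ?_, hξ, hξu, fun t _ => ?_,
    fun hind t _ => ?_⟩
  · exact hy.eqOn hgC1 hgN hN.le hcomm hF hV hUb hab hwp hu hv hξ
  · refine ⟨?_, ?_, rfl⟩
    · rw [hpair, phi_coordInv hgC1 hgN]
    · rw [hpair, phiInv_eq hgC1 hgN]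
  · exact (varphi_neg_of_indep hgC1 hgN hind (ξ t) (u t)).symm
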